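/- Let $S$ be an inverse semigroup with zero, ordered by its natural partial order ($a\le b$ iff $a=be$ for an idempotent $e$). A proper filter of $S$ is a non-empty, upwards closed, down-directed subset $A\subseteq S$ with $0\notin A$. The proper filters form a groupoid with $\mathbf d(A)=(A^{-1}A)^{\uparrow}$, $\mathbf r(A)=(AA^{-1})^{\uparrow}$, where $A\cdot B$ is defined iff $\mathbf d(A)=\mathbf r(B)$, and then $A\cdot B=(AB)^{\uparrow}$. For $a_1,\dots,a_m\le a$ in $S$ ($m\ge 0$) let $U_{a;a_1,\dots,a_m}$ be the set of the proper filters that contain $a$ and none of $a_1,\dots,a_m$. The Booleanization $\mathsf B(S)$ is the Boolean inverse semigroup of all finite compatible unions of sets $U_{a;a_1,\dots,a_m}$, that is, of the finite unions of such sets on which $\mathbf d$ and $\mathbf r$ are injective, under multiplication of subsets of the groupoid, with zero $\varnothing$. Let $\beta\colon S\to\mathsf B(S)$ be the homomorphism $a\mapsto U_a$. If $S$ is a monoid then so is $\mathsf B(S)$, with identity $U_1$. A map $\varphi$ from a Boolean inverse semigroup to a ring is additive if $\varphi(a\vee b)=\varphi(a)+\varphi(b)$ whenever $a$ and $b$ are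 orthogonal, i.e. $a^{-1}b=0=ab^{-1}$. (1) Let $S$ be an inverse monoid with zero, let $R$ be a unital ring, and let $\theta\colon S\to R$ be a representation, i.e. a monoid homomorphism to the multiplicative monoid of $R$ with $\theta(0)=0$. Then there is exactly one additive representation $\theta^{*}\colon\mathsf B(S)\to R$ such that $\theta^{*}\beta=\theta$. (2) Let $S$ be an inverse semigroup with zero, let $C$ be a $C^{*}$-algebra (not necessarily unital), and let $\theta\colon S\to C$ be a $*$-representation, i.e. a multiplicative map with $\theta(0)=0$ and $\theta(s^{-1})=\theta(s)^{*}$ for all $s\in S$. Then there is exactly one additive $*$-representation $\Theta\colon\mathsf B(S)\to C$ such that $\Theta\beta=\theta$. -/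

import Mathlib

set_option linter.unusedSectionVars false

/-- An inverse semigroup: each element `a` has exactly one `b` with `aba = a` and `bab = b`. -/
class IsInverseSemigroup (S : Type*) [Semigroup S] : Prop where
  existsUnique_inv : ∀ a : S, ∃! b : S, a * b * a = a ∧ b * a * b = b

namespace InvSemi

section Basic

variable {S : Type*} [Semigroup S] [IsInverseSemigroup S]

/-- The inverse `a⁻¹` of an element of an inverse semigroup. -/
noncomputable def sinv (a : S) : S := (IsInverseSemigroup.existsUnique_inv a).choose

/-- The natural partial order: `a ≼ b` iff `a = b e` for some idempotent `e`. -/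
def NatLE (a b : S) : Prop := ∃ e : S, e * e = e ∧ a = b * e

infix:50 " ≼ " => NatLE

/-- `a ∼ b`: both `a⁻¹ b` and `a b⁻¹` are idempotent. -/
def Compatible (a b : S) : Prop :=
  (sinv a * b) * (sinv a * b) = sinv a * b ∧ (a * sinv b) * (a * sinv b) = a * sinv b

/-- `c` is the join `a ∨ b` with respect to the natural partial order. -/
def IsJoin (a b c : S) : Prop := a ≼ c ∧ b ≼ c ∧ ∀ x, a ≼ x → b ≼ x → c ≼ x

theorem mul_sinv_mul (a : S) : a * sinv a * a = a :=
  (IsInverseSemigroup.existsUnique_inv a).choose_spec.1.1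

theorem sinv_mul_sinv (a : S) : sinv a * a * sinv a = sinv a :=
  (IsInverseSemigroup.existsUnique_inv a).choose_spec.1.2

theorem eq_sinv {a b : S} (h₁ : a * b * a = a) (h₂ : b * a * b = b) : b = sinv a :=
  (IsInverseSemigroup.existsUnique_inv a).choose_spec.2 b ⟨h₁, h₂⟩

theorem mul_sinv_mul_assoc (a x : S) : a * (sinv a * (a * x)) = a * x := by
  rw [← mul_assoc, ← mul_assoc, mul_sinv_mul]

theorem sinv_mul_sinv_assoc (a x : S) : sinv a * (a * (sinv a * x)) = sinv a * x := by
  rw [← mul_assoc, ← mul_assoc, sinv_mul_sinv]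

theorem sinv_sinv (a : S) : sinv (sinv a) = a :=
  (eq_sinv (sinv_mul_sinv a) (mul_sinv_mul a)).symm

theorem sinv_idem {e : S} (he : e * e = e) : sinv e = e :=
  (eq_sinv (by rw [he, he]) (by rw [he, he])).symm

theorem idem_mul_idem {e f : S} (he : e * e = e) (hf : f * f = f) :
    (e * f) * (e * f) = e * f := by
  have h1 := mul_sinv_mul (e * f)
  have h2 := sinv_mul_sinv (e * f)
  set x := sinv (e * f) with hx
  have he' (y : S) : e * (e * y) = e * y := by rw [← mul_assoc, he]
  have hf' (y : S) : f * (f * y) = f * y := by rw [← mul_assoc, hf]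
  simp only [mul_assoc] at h1 h2
  have h2' (y : S) : x * (e * (f * (x * y))) = x * y := by
    simpa only [mul_assoc] using congrArg (· * y) h2
  have h3 : f * x * e = x := by
    apply eq_sinv
    · simp only [mul_assoc, he', hf', h1]
    · simp only [mul_assoc, he', hf', h2']
  have h4 : x * x = x := by
    have : (f * x * e) * (f * x * e) = f * x * e := by
      simp only [mul_assoc, h2']
    rwa [h3] at this
  have h5 : x = e * f := by
    rw [← sinv_idem h4, hx, sinv_sinv]
  rw [← h5, h4]

theorem idem_comm {e f : S} (he : e * e = e) (hf : f * f = f) : e * f = f * e := by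
  have he' (y : S) : e * (e * y) = e * y := by rw [← mul_assoc, he]
  have hf' (y : S) : f * (f * y) = f * y := by rw [← mul_assoc, hf]
  have h1 := idem_mul_idem he hf
  have h2 := idem_mul_idem hf he
  have h3 : f * e = sinv (e * f) := by
    apply eq_sinv
    · simp only [mul_assoc, he', hf'] at h1 ⊢
      exact h1
    · simp only [mul_assoc, he', hf'] at h2 ⊢
      exact h2
  rw [h3, sinv_idem h1]

theorem d_idem (a : S) : (sinv a * a) * (sinv a * a) = sinv a * a := by
  rw [← mul_assoc, sinv_mul_sinv]

theorem r_idem (a : S) : (a * sinv a) * (a * sinv a) = a * sinv a := by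
  rw [← mul_assoc, mul_sinv_mul]

theorem sinv_mul (a b : S) : sinv (a * b) = sinv b * sinv a := by
  have h := idem_comm (d_idem a) (r_idem b)
  symm
  apply eq_sinv
  · calc a * b * (sinv b * sinv a) * (a * b)
        = a * ((b * sinv b) * (sinv a * a)) * b := by simp only [mul_assoc]
      _ = (a * sinv a * a) * (b * sinv b * b) := by rw [← h]; simp only [mul_assoc]
      _ = a * b := by rw [mul_sinv_mul, mul_sinv_mul]
  · calc sinv b * sinv a * (a * b) * (sinv b * sinv a)
        = sinv b * ((sinv a * a) * (b * sinv b)) * sinv a := by simp only [mul_assoc]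
      _ = (sinv b * b * sinv b) * (sinv a * a * sinv a) := by rw [h]; simp only [mul_assoc]
      _ = sinv b * sinv a := by rw [sinv_mul_sinv, sinv_mul_sinv]

theorem conj_idem {e : S} (he : e * e = e) (c : S) :
    (sinv c * e * c) * (sinv c * e * c) = sinv c * e * c := by
  calc (sinv c * e * c) * (sinv c * e * c)
      = sinv c * (e * (c * sinv c)) * (e * c) := by simp only [mul_assoc]
    _ = (sinv c * c * sinv c) * (e * e) * c := by
        rw [idem_comm he (r_idem c)]; simp only [mul_assoc]
    _ = sinv c * e * c := by rw [sinv_mul_sinv, he]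

theorem idem_mul_eq {e : S} (he : e * e = e) (c : S) : e * c = c * (sinv c * e * c) := by
  calc e * c = e * (c * sinv c) * c := by rw [mul_assoc, mul_sinv_mul]
    _ = c * (sinv c * e * c) := by rw [idem_comm he (r_idem c)]; simp only [mul_assoc]

theorem natLE_refl (a : S) : a ≼ a :=
  ⟨sinv a * a, d_idem a, by rw [← mul_assoc, mul_sinv_mul]⟩

theorem NatLE.trans {a b c : S} (h₁ : a ≼ b) (h₂ : b ≼ c) : a ≼ c := by
  obtain ⟨e, he, rfl⟩ := h₁
  obtain ⟨f, hf, rfl⟩ := h₂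
  exact ⟨f * e, idem_mul_idem hf he, mul_assoc _ _ _⟩

theorem mul_idem_le {e : S} (he : e * e = e) (a : S) : a * e ≼ a := ⟨e, he, rfl⟩

theorem idem_mul_le {e : S} (he : e * e = e) (a : S) : e * a ≼ a :=
  ⟨_, conj_idem he a, idem_mul_eq he a⟩

theorem NatLE.antisymm {a b : S} (h₁ : a ≼ b) (h₂ : b ≼ a) : a = b := by
  obtain ⟨e, he, h₁⟩ := h₁
  obtain ⟨f, hf, h₂⟩ := h₂
  have h3 : a * e = a := by rw [h₁, mul_assoc, he]
  calc a = b * e := h₁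
    _ = a * (f * e) := by rw [h₂, mul_assoc]
    _ = a * e * f := by rw [idem_comm hf he, mul_assoc]
    _ = b := by rw [h3, ← h₂]

theorem NatLE.eq_mul_d {a b : S} (h : a ≼ b) : b * (sinv a * a) = a := by
  obtain ⟨e, he, h⟩ := h
  have h3 : a * e = a := by rw [h, mul_assoc, he]
  calc b * (sinv a * a) = b * (sinv a * a * e) := by rw [mul_assoc, h3]
    _ = b * e * (sinv a * a) := by rw [idem_comm (d_idem a) he, mul_assoc]
    _ = a := by rw [← h, ← mul_assoc, mul_sinv_mul]

theorem NatLE.mul {a b c x : S} (h₁ : a ≼ b) (h₂ : c ≼ x) : a * c ≼ b * x := by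
  obtain ⟨e, he, rfl⟩ := h₁
  obtain ⟨f, hf, rfl⟩ := h₂
  refine NatLE.trans (b := b * e * x) ⟨f, hf, (mul_assoc _ _ _).symm⟩ ?_
  rw [mul_assoc, idem_mul_eq he]
  exact ⟨_, conj_idem he x, (mul_assoc _ _ _).symm⟩

theorem NatLE.sinv {a b : S} (h : a ≼ b) : sinv a ≼ sinv b := by
  obtain ⟨e, he, rfl⟩ := h
  rw [sinv_mul, sinv_idem he]
  exact idem_mul_le he _

theorem NatLE.idem {a e : S} (h : a ≼ e) (he : e * e = e) : a * a = a := by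
  obtain ⟨f, hf, rfl⟩ := h
  exact idem_mul_idem he hf

/-- Upward closure of the product of two subsets. -/
def upMul (A B : Set S) : Set S := {x | ∃ a ∈ A, ∃ b ∈ B, a * b ≼ x}

/-- The set `A⁻¹` of inverses of the elements of `A`. -/
def invSet (A : Set S) : Set S := {x | sinv x ∈ A}

theorem upMul_assoc (A B C : Set S) : upMul (upMul A B) C = upMul A (upMul B C) := by
  ext x
  constructor
  · rintro ⟨y, ⟨a, ha, b, hb, hy⟩, c, hc, hx⟩
    exact ⟨a, ha, b * c, ⟨b, hb, c, hc, natLE_refl _⟩,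
      (by rw [← mul_assoc]; exact (hy.mul (natLE_refl c)).trans hx)⟩
  · rintro ⟨a, ha, y, ⟨b, hb, c, hc, hy⟩, hx⟩
    exact ⟨a * b, ⟨a, ha, b, hb, natLE_refl _⟩, c, hc,
      (by rw [mul_assoc]; exact ((natLE_refl a).mul hy).trans hx)⟩

theorem invSet_invSet (A : Set S) : invSet (invSet A) = A := by
  ext x; simp [invSet, sinv_sinv]

theorem invSet_upMul (A B : Set S) : invSet (upMul A B) = upMul (invSet B) (invSet A) := by
  ext x
  constructor
  · rintro ⟨a, ha, b, hb, h⟩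
    refine ⟨sinv b, by simpa [invSet, sinv_sinv] using hb, sinv a,
      by simpa [invSet, sinv_sinv] using ha, ?_⟩
    have := h.sinv
    rwa [sinv_sinv, sinv_mul] at this
  · rintro ⟨b, hb, a, ha, h⟩
    refine ⟨sinv a, ha, sinv b, hb, ?_⟩
    rw [← sinv_mul]
    exact h.sinv

end Basic

section WithZero

variable {S : Type*} [SemigroupWithZero S] [IsInverseSemigroup S]

/-- `a ⟂ b`: `a⁻¹ b = 0 = a b⁻¹`. -/
def Orthogonal (a b : S) : Prop := sinv a * b = 0 ∧ a * sinv b = 0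

theorem eq_zero_of_le {a : S} (h : a ≼ 0) : a = 0 := by
  obtain ⟨e, -, rfl⟩ := h
  exact zero_mul e

end WithZero

end InvSemi

open InvSemi in
/-- A Boolean inverse semigroup: binary joins of compatible elements exist, multiplication
distributes over them on both sides, and the idempotents form a generalized Boolean algebra. (The
idempotents are then a distributive lattice, so only relative complements have to be required.) -/
class IsBooleanInverseSemigroup (S : Type*) [SemigroupWithZero S] : Prop
    extends IsInverseSemigroup S where
  exists_join : ∀ a b : S, Compatible a b → ∃ c, IsJoin a b c
  join_mul : ∀ a b c x : S, Compatible a b → IsJoin a b c → IsJoin (a * x) (b * x) (c * x)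
  mul_join : ∀ a b c x : S, Compatible a b → IsJoin a b c → IsJoin (x * a) (x * b) (x * c)
  exists_compl : ∀ e f : S, e * e = e → f * f = f → f ≼ e →
    ∃ g, g * g = g ∧ g * f = 0 ∧ IsJoin g f e

namespace InvSemi

/-- A map from a Boolean inverse semigroup to a ring is additive if `φ (a ∨ b) = φ a + φ b`
whenever `a` and `b` are orthogonal. -/
def IsAdditive {T R : Type*} [SemigroupWithZero T] [IsBooleanInverseSemigroup T] [Add R]
    (φ : T → R) : Prop :=
  ∀ a b c : T, Orthogonal a b → IsJoin a b c → φ c = φ a + φ b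

/-- A `∗`-representation of an inverse semigroup with zero in a `C*`-algebra: a homomorphism of
semigroups that preserves zero and turns inverses into adjoints. -/
structure IsStarRep {S C : Type*} [SemigroupWithZero S] [IsInverseSemigroup S]
    [NonUnitalCStarAlgebra C] (θ : S →ₙ* C) : Prop where
  map_zero : θ 0 = 0
  map_inv : ∀ s : S, θ (sinv s) = star (θ s)

/-- The proper filters of an inverse semigroup with zero, for the natural partial order. -/
@[ext]
structure ProperFilter (S : Type*) [SemigroupWithZero S] where
  carrier : Set S
  nonempty : carrier.Nonempty
  up : ∀ {a b : S}, a ∈ carrier → a ≼ b → b ∈ carrier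
  directed : ∀ {a b : S}, a ∈ carrier → b ∈ carrier → ∃ c ∈ carrier, c ≼ a ∧ c ≼ b
  zero_notMem : (0 : S) ∉ carrier

namespace ProperFilter

variable {S : Type*} [SemigroupWithZero S] [IsInverseSemigroup S]

/-- `d(A) = (A⁻¹ A)↑`, the domain of the arrow `A` of the groupoid of proper filters. -/
def dom (A : ProperFilter S) : Set S := upMul (invSet A.carrier) A.carrier

/-- `r(A) = (A A⁻¹)↑`, the range of the arrow `A` of the groupoid of proper filters. -/
def ran (A : ProperFilter S) : Set S := upMul A.carrier (invSet A.carrier)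

/-- In the groupoid of proper filters `A · B` is defined iff `d(A) = r(B)`, and then it is
`(A B)↑`; this says that it is defined and equal to `C`. -/
def IsProd (A B C : ProperFilter S) : Prop :=
  A.dom = B.ran ∧ C.carrier = upMul A.carrier B.carrier

theorem mem_dom_iff (A : ProperFilter S) (x : S) :
    x ∈ A.dom ↔ ∃ a ∈ A.carrier, sinv a * a ≼ x := by
  constructor
  · rintro ⟨a, ha, b, hb, h⟩
    obtain ⟨c, hc, h1, h2⟩ := A.directed ha hb
    have h3 := h1.sinv
    rw [sinv_sinv] at h3
    exact ⟨c, hc, (h3.mul h2).trans h⟩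
  · rintro ⟨a, ha, h⟩
    exact ⟨sinv a, by simpa [invSet, sinv_sinv] using ha, a, ha, h⟩

theorem mem_ran_iff (A : ProperFilter S) (x : S) :
    x ∈ A.ran ↔ ∃ a ∈ A.carrier, a * sinv a ≼ x := by
  constructor
  · rintro ⟨a, ha, b, hb, h⟩
    obtain ⟨c, hc, h1, h2⟩ := A.directed ha hb
    have h3 := h2.sinv
    rw [sinv_sinv] at h3
    exact ⟨c, hc, (h1.mul h3).trans h⟩
  · rintro ⟨a, ha, h⟩
    exact ⟨a, ha, sinv a, by simpa [invSet, sinv_sinv] using ha, h⟩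

theorem singleton_dom (A : ProperFilter S) {a : S} (ha : a ∈ A.carrier) :
    upMul {a} A.dom = A.carrier := by
  ext x
  constructor
  · rintro ⟨a, rfl, y, hy, h⟩
    obtain ⟨b, hb, hy⟩ := (A.mem_dom_iff y).1 hy
    obtain ⟨c, hc, h1, h2⟩ := A.directed ha hb
    refine A.up hc (NatLE.trans ?_ h)
    have h3 : c * (sinv c * c) ≼ a * y := h1.mul ((h2.sinv.mul h2).trans hy)
    rwa [← mul_assoc, mul_sinv_mul] at h3
  · intro hx
    obtain ⟨c, hc, h1, h2⟩ := A.directed ha hx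
    exact ⟨a, rfl, _, (A.mem_dom_iff _).2 ⟨c, hc, natLE_refl _⟩, by rw [h1.eq_mul_d]; exact h2⟩

theorem mul_dom (A : ProperFilter S) : upMul A.carrier A.dom = A.carrier := by
  ext x
  constructor
  · rintro ⟨a, ha, y, hy, h⟩
    rw [← A.singleton_dom ha]
    exact ⟨a, rfl, y, hy, h⟩
  · intro hx
    have h := hx
    rw [← A.singleton_dom hx] at h
    obtain ⟨_, rfl, y, hy, h⟩ := h
    exact ⟨_, hx, y, hy, h⟩

theorem ran_mul (A : ProperFilter S) : upMul A.ran A.carrier = A.carrier := by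
  rw [ran, upMul_assoc]
  exact A.mul_dom

/-- The inverse `A⁻¹` of an arrow of the groupoid of proper filters. -/
def inv (A : ProperFilter S) : ProperFilter S where
  carrier := invSet A.carrier
  nonempty := by
    obtain ⟨a, ha⟩ := A.nonempty
    exact ⟨sinv a, by simpa [invSet, sinv_sinv] using ha⟩
  up := fun ha h => A.up ha h.sinv
  directed := by
    intro a b ha hb
    obtain ⟨c, hc, h1, h2⟩ := A.directed ha hb
    refine ⟨sinv c, by simpa [invSet, sinv_sinv] using hc, ?_, ?_⟩
    · simpa [sinv_sinv] using h1.sinv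
    · simpa [sinv_sinv] using h2.sinv
  zero_notMem := by
    intro h
    have h0 : sinv (0 : S) = 0 := sinv_idem (zero_mul 0)
    exact A.zero_notMem (h0 ▸ h)

theorem inv_invol (A : ProperFilter S) : A.inv.inv = A :=
  ProperFilter.ext (invSet_invSet _)

theorem inv_dom (A : ProperFilter S) : A.inv.dom = A.ran := by
  simp only [dom, ran, inv, invSet_invSet]

theorem inv_ran (A : ProperFilter S) : A.inv.ran = A.dom := by
  simp only [dom, ran, inv, invSet_invSet]

/-- An identity of the groupoid of proper filters. -/
def IsIdentity (A : ProperFilter S) : Prop := ∃ e ∈ A.carrier, e * e = e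

theorem isIdentity_iff (A : ProperFilter S) : A.IsIdentity ↔ A.carrier = A.dom := by
  constructor
  · rintro ⟨e, he, hee⟩
    have h1 : ∀ a ∈ A.carrier, ∃ f ∈ A.carrier, f * f = f ∧ f ≼ a := by
      intro a ha
      obtain ⟨c, hc, h1, h2⟩ := A.directed he ha
      exact ⟨c, hc, h1.idem hee, h2⟩
    ext x
    rw [mem_dom_iff]
    constructor
    · intro hx
      obtain ⟨f, hf, hff, h⟩ := h1 x hx
      exact ⟨f, hf, by rwa [sinv_idem hff, hff]⟩
    · rintro ⟨a, ha, h⟩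
      obtain ⟨f, hf, hff, h'⟩ := h1 a ha
      refine A.up hf (NatLE.trans ?_ h)
      have := h'.sinv.mul h'
      rwa [sinv_idem hff, hff] at this
  · intro h
    obtain ⟨a, ha⟩ := A.nonempty
    refine ⟨sinv a * a, ?_, d_idem a⟩
    rw [h, mem_dom_iff]
    exact ⟨a, ha, natLE_refl _⟩

theorem dom_eq_of_prod {A B C : ProperFilter S} (h : IsProd A B C) : C.dom = B.dom := by
  obtain ⟨h1, h2⟩ := h
  have : C.dom = upMul (invSet B.carrier) (upMul A.dom B.carrier) := by
    simp only [dom, h2, invSet_upMul, upMul_assoc]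
  rw [this, h1, ran_mul, dom]

theorem ran_eq_of_prod {A B C : ProperFilter S} (h : IsProd A B C) : C.ran = A.ran := by
  obtain ⟨h1, h2⟩ := h
  have : C.ran = upMul (upMul A.carrier B.ran) (invSet A.carrier) := by
    simp only [ran, h2, invSet_upMul, upMul_assoc]
  rw [this, ← h1, mul_dom, ran]

theorem exists_prod {A B : ProperFilter S} (h : A.dom = B.ran) : ∃ C, IsProd A B C := by
  refine ⟨⟨upMul A.carrier B.carrier, ?_, ?_, ?_, ?_⟩, h, rfl⟩
  · obtain ⟨a, ha⟩ := A.nonempty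
    obtain ⟨b, hb⟩ := B.nonempty
    exact ⟨a * b, a, ha, b, hb, natLE_refl _⟩
  · rintro x y ⟨a, ha, b, hb, h⟩ h'
    exact ⟨a, ha, b, hb, h.trans h'⟩
  · rintro x y ⟨a, ha, b, hb, h⟩ ⟨a', ha', b', hb', h'⟩
    obtain ⟨c, hc, h1, h2⟩ := A.directed ha ha'
    obtain ⟨d, hd, h3, h4⟩ := B.directed hb hb'
    exact ⟨c * d, ⟨c, hc, d, hd, natLE_refl _⟩, (h1.mul h3).trans h, (h2.mul h4).trans h'⟩
  · rintro ⟨a, ha, b, hb, hab⟩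
    have hab := eq_zero_of_le hab
    have h1 : sinv a * a ∈ B.ran := by
      rw [← h, mem_dom_iff]
      exact ⟨a, ha, natLE_refl _⟩
    have h2 : sinv a * a * b ∈ B.carrier := by
      rw [← B.ran_mul]
      exact ⟨_, h1, b, hb, natLE_refl _⟩
    rw [mul_assoc, hab, mul_zero] at h2
    exact B.zero_notMem h2

/-- If `A · B = C` then `A⁻¹ · C = B`. -/
theorem IsProd.inv_left {A B C : ProperFilter S} (h : IsProd A B C) : IsProd A.inv C B := by
  refine ⟨by rw [inv_dom, ran_eq_of_prod h], ?_⟩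
  rw [h.2, ← upMul_assoc]
  change _ = upMul A.dom _
  rw [h.1, ran_mul]

/-- If `A · B = C` then `B⁻¹ · A⁻¹ = C⁻¹`. -/
theorem IsProd.inv {A B C : ProperFilter S} (h : IsProd A B C) : IsProd B.inv A.inv C.inv := by
  refine ⟨by rw [inv_dom, inv_ran, h.1], ?_⟩
  simp only [ProperFilter.inv, h.2, invSet_upMul]

/-- If `A · B = C` then `C · B⁻¹ = A`. -/
theorem IsProd.inv_right {A B C : ProperFilter S} (h : IsProd A B C) : IsProd C B.inv A := by
  simpa only [inv_invol] using h.inv.inv_left.inv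

/-- The principal filter `a↑` of a nonzero element. -/
def principal (a : S) (ha : a ≠ 0) : ProperFilter S where
  carrier := {x | a ≼ x}
  nonempty := ⟨a, natLE_refl a⟩
  up := fun h h' => NatLE.trans h h'
  directed := fun h h' => ⟨a, natLE_refl a, h, h'⟩
  zero_notMem := fun h => ha (eq_zero_of_le h)

end ProperFilter

section Bisections

open ProperFilter

variable {S : Type*} [SemigroupWithZero S] [IsInverseSemigroup S]

/-- A partial bisection of the groupoid of proper filters: a set of arrows on which `d` and `r`
are injective. -/
def IsPartialBisection (X : Set (ProperFilter S)) : Prop :=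
  (∀ A ∈ X, ∀ B ∈ X, A.dom = B.dom → A = B) ∧ (∀ A ∈ X, ∀ B ∈ X, A.ran = B.ran → A = B)

/-- The product of two sets of arrows. -/
def prodSet (X Y : Set (ProperFilter S)) : Set (ProperFilter S) :=
  {C | ∃ A ∈ X, ∃ B ∈ Y, IsProd A B C}

/-- The basic set `U_{a; a₁, …, aₘ}` of the proper filters that contain `a` and none of the
elements `a₁, …, aₘ` of `T`. -/
def basicSet (a : S) (T : Set S) : Set (ProperFilter S) :=
  {A | a ∈ A.carrier ∧ ∀ t ∈ T, t ∉ A.carrier}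

/-- The collection of all the sets `U_{a; a₁, …, aₘ}` with `m ≥ 0` and `a₁, …, aₘ ≼ a`. -/
def basicSets (S : Type*) [SemigroupWithZero S] [IsInverseSemigroup S] :
    Set (Set (ProperFilter S)) :=
  {X | ∃ (a : S) (T : Set S), T.Finite ∧ (∀ t ∈ T, t ≼ a) ∧ X = basicSet a T}

/-- The finite unions of basic sets. -/
def IsFiniteUnion (X : Set (ProperFilter S)) : Prop :=
  ∃ F : Set (Set (ProperFilter S)), F.Finite ∧ F ⊆ basicSets S ∧ X = ⋃₀ F

theorem isPartialBisection_basicSet (a : S) (T : Set S) : IsPartialBisection (basicSet a T) := by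
  have key : ∀ (a : S) (A B : ProperFilter S), a ∈ A.carrier → a ∈ B.carrier →
      A.dom = B.dom → A = B := by
    intro a A B hA hB h
    apply ProperFilter.ext
    rw [← A.singleton_dom hA, ← B.singleton_dom hB, h]
  refine ⟨fun A hA B hB h => key a A B hA.1 hB.1 h, fun A hA B hB h => ?_⟩
  have := key (sinv a) A.inv B.inv (by simpa [ProperFilter.inv, invSet, sinv_sinv] using hA.1)
    (by simpa [ProperFilter.inv, invSet, sinv_sinv] using hB.1) (by rw [inv_dom, inv_dom, h])
  rw [← inv_invol A, this, inv_invol]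

theorem IsPartialBisection.subset {X Y : Set (ProperFilter S)} (hY : IsPartialBisection Y)
    (h : X ⊆ Y) : IsPartialBisection X :=
  ⟨fun A hA B hB => hY.1 A (h hA) B (h hB), fun A hA B hB => hY.2 A (h hA) B (h hB)⟩

theorem IsPartialBisection.prodSet {X Y : Set (ProperFilter S)} (hX : IsPartialBisection X)
    (hY : IsPartialBisection Y) : IsPartialBisection (prodSet X Y) := by
  constructor
  · rintro C ⟨A, hA, B, hB, h⟩ C' ⟨A', hA', B', hB', h'⟩ hC
    rw [dom_eq_of_prod h, dom_eq_of_prod h'] at hC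
    obtain rfl := hY.1 B hB B' hB' hC
    obtain rfl := hX.1 A hA A' hA' (by rw [h.1, h'.1])
    exact ProperFilter.ext (by rw [h.2, h'.2])
  · rintro C ⟨A, hA, B, hB, h⟩ C' ⟨A', hA', B', hB', h'⟩ hC
    rw [ran_eq_of_prod h, ran_eq_of_prod h'] at hC
    obtain rfl := hX.2 A hA A' hA' hC
    obtain rfl := hY.2 B hB B' hB' (by rw [← h.1, ← h'.1])
    exact ProperFilter.ext (by rw [h.2, h'.2])

theorem basicSet_zero (T : Set S) : basicSet 0 T = ∅ := by
  ext A
  simp only [Set.mem_empty_iff_false, iff_false]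
  exact fun h => A.zero_notMem h.1

theorem prodSet_basicSet (a b : S) (T T' : Set S) :
    prodSet (basicSet a T) (basicSet b T') =
      basicSet (a * b) ((fun t => a * t) '' T' ∪ (fun t => t * b) '' T) := by
  ext C
  constructor
  · rintro ⟨A, ⟨hA, hAT⟩, B, ⟨hB, hBT⟩, h⟩
    refine ⟨by rw [h.2]; exact ⟨a, hA, b, hB, natLE_refl _⟩, ?_⟩
    rintro _ (⟨t, ht, rfl⟩ | ⟨t, ht, rfl⟩) hC
    · apply hBT t ht
      refine B.up (a := sinv a * (a * t)) ?_ (by rw [← mul_assoc]; exact idem_mul_le (d_idem a) t)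
      rw [h.inv_left.2]
      exact ⟨sinv a, by simpa [ProperFilter.inv, invSet, sinv_sinv] using hA, _, hC, natLE_refl _⟩
    · apply hAT t ht
      refine A.up (a := t * b * sinv b) ?_ (by rw [mul_assoc]; exact mul_idem_le (r_idem b) t)
      rw [h.inv_right.2]
      exact ⟨_, hC, sinv b, by simpa [ProperFilter.inv, invSet, sinv_sinv] using hB, natLE_refl _⟩
  · rintro ⟨hC, hCT⟩
    have hd : sinv b * b ∈ C.dom := by
      rw [mem_dom_iff]
      refine ⟨_, hC, ⟨sinv (a * b) * (a * b), d_idem _, ?_⟩⟩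
      rw [sinv_mul]
      simp only [mul_assoc, sinv_mul_sinv_assoc]
    have hup : ∀ {x y : S}, x ∈ C.dom → x ≼ y → y ∈ C.dom := by
      intro x y hx h
      rw [mem_dom_iff] at hx ⊢
      obtain ⟨c, hc, h'⟩ := hx
      exact ⟨c, hc, h'.trans h⟩
    have hlow : ∀ {x y : S}, x ∈ C.dom → y ∈ C.dom → ∃ z ∈ C.dom, z ≼ x ∧ z ≼ y := by
      intro x y hx hy
      rw [mem_dom_iff] at hx hy
      obtain ⟨c, hc, h⟩ := hx
      obtain ⟨c', hc', h'⟩ := hy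
      obtain ⟨k, hk, h1, h2⟩ := C.directed hc hc'
      exact ⟨sinv k * k, (C.mem_dom_iff _).2 ⟨k, hk, natLE_refl _⟩,
        (h1.sinv.mul h1).trans h, (h2.sinv.mul h2).trans h'⟩
    have hbB : b ∈ upMul {b} C.dom :=
      ⟨b, rfl, _, hd, by rw [← mul_assoc, mul_sinv_mul]; exact natLE_refl b⟩
    let B : ProperFilter S :=
      { carrier := upMul {b} C.dom
        nonempty := ⟨b, hbB⟩
        up := by
          rintro x y ⟨c, hc, z, hz, h⟩ h'
          exact ⟨c, hc, z, hz, h.trans h'⟩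
        directed := by
          rintro x y ⟨_, rfl, z, hz, h⟩ ⟨_, rfl, z', hz', h'⟩
          obtain ⟨k, hk, h1, h2⟩ := hlow hz hz'
          exact ⟨_ * k, ⟨_, rfl, k, hk, natLE_refl _⟩, ((natLE_refl _).mul h1).trans h,
            ((natLE_refl _).mul h2).trans h'⟩
        zero_notMem := by
          rintro ⟨c, hc, z, hz, h⟩
          obtain rfl : c = b := hc
          have hz' : a * (c * z) ∈ C.carrier := by
            rw [← C.mul_dom]
            exact ⟨_, hC, z, hz, by rw [mul_assoc]; exact natLE_refl _⟩
          rw [eq_zero_of_le h, mul_zero] at hz'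
          exact C.zero_notMem hz' }
    have hBd : B.dom = C.dom := by
      ext x
      rw [mem_dom_iff]
      constructor
      · rintro ⟨y, ⟨_, rfl, z, hz, h⟩, h'⟩
        obtain ⟨k, hk, h1, h2⟩ := hlow hd hz
        obtain ⟨c, hc, hck⟩ := (C.mem_dom_iff k).1 hk
        refine hup ((C.mem_dom_iff _).2 ⟨c, hc, natLE_refl _⟩) (NatLE.trans ?_ h')
        have h3 := (natLE_refl _).mul (hck.trans h2) |>.trans h
        have h4 := h3.sinv.mul h3
        rw [sinv_mul, sinv_idem (d_idem c)] at h4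
        refine NatLE.trans ?_ h4
        have h5 := (hck.trans h1).eq_mul_d
        rw [sinv_idem (d_idem c), d_idem] at h5
        rw [mul_assoc, ← mul_assoc (sinv _) _ (sinv c * c), h5, d_idem]
        exact natLE_refl _
      · intro hx
        obtain ⟨k, hk, h1, h2⟩ := hlow hd hx
        obtain ⟨c, hc, hck⟩ := (C.mem_dom_iff k).1 hk
        refine ⟨b * (sinv c * c), ⟨b, rfl, _, (C.mem_dom_iff _).2 ⟨c, hc, natLE_refl _⟩,
          natLE_refl _⟩, NatLE.trans ?_ (hck.trans h2)⟩
        rw [sinv_mul, sinv_idem (d_idem c)]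
        have h5 := (hck.trans h1).eq_mul_d
        rw [sinv_idem (d_idem c), d_idem] at h5
        rw [mul_assoc, ← mul_assoc (sinv _) _ (sinv c * c), h5, d_idem]
        exact natLE_refl _
    obtain ⟨A, hA⟩ := exists_prod (A := C) (B := B.inv) (by rw [inv_ran, hBd])
    have hP : IsProd A B C := by simpa only [inv_invol] using hA.inv_right
    have haA : a ∈ A.carrier := by
      rw [hA.2]
      exact ⟨a * b, hC, sinv b, by simpa [ProperFilter.inv, invSet, sinv_sinv] using hbB,
        by rw [mul_assoc]; exact mul_idem_le (r_idem b) a⟩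
    refine ⟨A, ⟨haA, ?_⟩, B, ⟨hbB, ?_⟩, hP⟩
    · intro t ht h
      apply hCT (t * b) (Or.inr ⟨t, ht, rfl⟩)
      rw [hP.2]
      exact ⟨t, h, b, hbB, natLE_refl _⟩
    · intro t ht h
      apply hCT (a * t) (Or.inl ⟨t, ht, rfl⟩)
      rw [hP.2]
      exact ⟨a, haA, t, h, natLE_refl _⟩

theorem prodSet_assoc (X Y Z : Set (ProperFilter S)) :
    prodSet (prodSet X Y) Z = prodSet X (prodSet Y Z) := by
  ext C
  constructor
  · rintro ⟨D, ⟨A, hA, B, hB, h⟩, E, hE, h'⟩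
    obtain ⟨F, hF⟩ := exists_prod (A := B) (B := E) (by rw [← dom_eq_of_prod h, h'.1])
    exact ⟨A, hA, F, ⟨B, hB, E, hE, hF⟩, by rw [h.1, ran_eq_of_prod hF],
      by rw [h'.2, h.2, hF.2, upMul_assoc]⟩
  · rintro ⟨A, hA, D, ⟨B, hB, E, hE, h⟩, h'⟩
    obtain ⟨F, hF⟩ := exists_prod (A := A) (B := B) (by rw [← ran_eq_of_prod h, h'.1])
    exact ⟨F, ⟨A, hA, B, hB, hF⟩, E, hE, by rw [← h.1, dom_eq_of_prod hF],
      by rw [h'.2, h.2, hF.2, upMul_assoc]⟩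

theorem isFiniteUnion_basicSet {a : S} {T : Set S} (hf : T.Finite) (hT : ∀ t ∈ T, t ≼ a) :
    IsFiniteUnion (basicSet a T) :=
  ⟨{basicSet a T}, Set.finite_singleton _, by rintro _ rfl; exact ⟨a, T, hf, hT, rfl⟩, by simp⟩

theorem isFiniteUnion_sUnion {F : Set (Set (ProperFilter S))} (hF : F.Finite)
    (h : ∀ X ∈ F, IsFiniteUnion X) : IsFiniteUnion (⋃₀ F) := by
  choose! G hG1 hG2 hG3 using h
  refine ⟨⋃ X ∈ F, G X, hF.biUnion hG1, by simpa using hG2, ?_⟩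
  ext A
  simp only [Set.mem_sUnion, Set.mem_iUnion]
  constructor
  · rintro ⟨X, hX, hA⟩
    rw [hG3 X hX] at hA
    obtain ⟨Y, hY, hA⟩ := hA
    exact ⟨Y, ⟨X, hX, hY⟩, hA⟩
  · rintro ⟨Y, ⟨X, hX, hY⟩, hA⟩
    exact ⟨X, hX, by rw [hG3 X hX]; exact ⟨Y, hY, hA⟩⟩

theorem isFiniteUnion_empty : IsFiniteUnion (∅ : Set (ProperFilter S)) :=
  ⟨∅, Set.finite_empty, Set.empty_subset _, by simp⟩

theorem IsFiniteUnion.union {X Y : Set (ProperFilter S)} (hX : IsFiniteUnion X)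
    (hY : IsFiniteUnion Y) : IsFiniteUnion (X ∪ Y) := by
  have := isFiniteUnion_sUnion (F := {X, Y}) (by simp) (by
    rintro Z (rfl | rfl)
    · exact hX
    · exact hY)
  simpa using this

theorem IsFiniteUnion.prodSet {X Y : Set (ProperFilter S)} (hX : IsFiniteUnion X)
    (hY : IsFiniteUnion Y) : IsFiniteUnion (prodSet X Y) := by
  obtain ⟨F, hF, hF', rfl⟩ := hX
  obtain ⟨G, hG, hG', rfl⟩ := hY
  refine ⟨Set.image2 InvSemi.prodSet F G, hF.image2 _ hG, ?_, ?_⟩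
  · rintro _ ⟨_, hU, _, hV, rfl⟩
    obtain ⟨a, T, hT, hTa, rfl⟩ := hF' hU
    obtain ⟨b, T', hT', hTb, rfl⟩ := hG' hV
    refine ⟨a * b, _, (hT'.image _).union (hT.image _), ?_, prodSet_basicSet a b T T'⟩
    rintro _ (⟨t, ht, rfl⟩ | ⟨t, ht, rfl⟩)
    · exact (natLE_refl a).mul (hTb t ht)
    · exact (hTa t ht).mul (natLE_refl b)
  · ext C
    constructor
    · rintro ⟨A, ⟨U, hU, hA⟩, B, ⟨V, hV, hB⟩, h⟩
      exact ⟨_, ⟨U, hU, V, hV, rfl⟩, A, hA, B, hB, h⟩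
    · rintro ⟨_, ⟨U, hU, V, hV, rfl⟩, A, hA, B, hB, h⟩
      exact ⟨A, ⟨U, hU, hA⟩, B, ⟨V, hV, hB⟩, h⟩

theorem mem_inv_carrier (A : ProperFilter S) (a : S) : a ∈ A.inv.carrier ↔ sinv a ∈ A.carrier :=
  Iff.rfl

theorem preimage_inv_basicSet (a : S) (T : Set S) :
    ProperFilter.inv ⁻¹' (basicSet a T) = basicSet (sinv a) (sinv '' T) := by
  ext A
  simp only [Set.mem_preimage, basicSet, Set.mem_ofPred_eq, mem_inv_carrier, Set.forall_mem_image]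

theorem IsFiniteUnion.inv {X : Set (ProperFilter S)} (hX : IsFiniteUnion X) :
    IsFiniteUnion (ProperFilter.inv ⁻¹' X) := by
  obtain ⟨F, hF, hF', rfl⟩ := hX
  rw [Set.preimage_sUnion, ← Set.sUnion_image]
  apply isFiniteUnion_sUnion (hF.image _)
  rintro _ ⟨U, hU, rfl⟩
  obtain ⟨a, T, hT, hTa, rfl⟩ := hF' hU
  rw [preimage_inv_basicSet]
  apply isFiniteUnion_basicSet (hT.image _)
  rintro _ ⟨t, ht, rfl⟩
  exact (hTa t ht).sinv

theorem IsPartialBisection.inv {X : Set (ProperFilter S)} (hX : IsPartialBisection X) :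
    IsPartialBisection (ProperFilter.inv ⁻¹' X) := by
  constructor
  · intro A hA B hB h
    have := hX.2 _ hA _ hB (by rw [inv_ran, inv_ran, h])
    rw [← inv_invol A, this, inv_invol]
  · intro A hA B hB h
    have := hX.1 _ hA _ hB (by rw [inv_dom, inv_dom, h])
    rw [← inv_invol A, this, inv_invol]

end Bisections

end InvSemi

open InvSemi ProperFilter

/-- The Booleanization `B(S)` of an inverse semigroup with zero: all finite compatible joins of
basic sets `U_{a; a₁, …, aₘ}` in the inverse semigroup of partial bisections of the groupoid of
proper filters of `S`. (A family of partial bisections is compatible exactly if its union is a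
partial bisection, and then its join is the union.) -/
@[ext]
structure Booleanization (S : Type*) [SemigroupWithZero S] [IsInverseSemigroup S] where
  carrier : Set (ProperFilter S)
  isPartialBisection : IsPartialBisection carrier
  isFiniteUnion : IsFiniteUnion carrier

namespace Booleanization

section WithZero

variable {S : Type*} [SemigroupWithZero S] [IsInverseSemigroup S]

/-- The multiplication of `B(S)` is the product of sets of arrows, the zero is the empty set. -/
instance : SemigroupWithZero (Booleanization S) where
  mul X Y := ⟨prodSet X.carrier Y.carrier, X.isPartialBisection.prodSet Y.isPartialBisection,
    X.isFiniteUnion.prodSet Y.isFiniteUnion⟩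
  mul_assoc X Y Z := Booleanization.ext (prodSet_assoc X.carrier Y.carrier Z.carrier)
  zero := ⟨∅, ⟨by simp, by simp⟩, isFiniteUnion_empty⟩
  zero_mul X := Booleanization.ext (by
    ext C
    constructor
    · rintro ⟨A, hA, -⟩
      exact hA.elim
    · intro h
      exact h.elim)
  mul_zero X := Booleanization.ext (by
    ext C
    constructor
    · rintro ⟨A, -, B, hB, -⟩
      exact hB.elim
    · intro h
      exact h.elim)

theorem carrier_mul (X Y : Booleanization S) :
    (X * Y).carrier = prodSet X.carrier Y.carrier := rfl

theorem carrier_zero : (0 : Booleanization S).carrier = ∅ := rfl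

/-- The set of inverses of the arrows of `X`. -/
def inv (X : Booleanization S) : Booleanization S :=
  ⟨ProperFilter.inv ⁻¹' X.carrier, X.isPartialBisection.inv, X.isFiniteUnion.inv⟩

theorem mul_inv_mul (X : Booleanization S) : X * X.inv * X = X := by
  apply Booleanization.ext
  ext C
  constructor
  · rintro ⟨D, ⟨A, hA, B, hB, h⟩, E, hE, h'⟩
    have h1 : A = B.inv := X.isPartialBisection.1 _ hA _ hB (by rw [inv_dom, h.1])
    have h2 : E = B.inv := X.isPartialBisection.2 _ hE _ hB (by
      rw [inv_ran, ← h'.1, dom_eq_of_prod h])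
    subst h2
    have h3 := h'.inv_right
    rw [inv_invol] at h3
    have : C = A := ProperFilter.ext (by
      rw [h'.2, h.2, upMul_assoc]
      change upMul A.carrier B.ran = _
      rw [← h.1, mul_dom])
    rwa [this]
  · intro hC
    obtain ⟨D, hD⟩ := exists_prod (A := C) (B := C.inv) (by rw [inv_ran])
    refine ⟨D, ⟨C, hC, C.inv, by rwa [inv, Set.mem_preimage, inv_invol], hD⟩, C, hC, ?_⟩
    simpa only [inv_invol] using hD.inv_right

theorem inv_inv_eq (X : Booleanization S) : X.inv.inv = X := by
  apply Booleanization.ext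
  ext A
  simp only [inv, Set.mem_preimage, inv_invol]

theorem carrier_inv_subset {X Y : Booleanization S} (h : X * Y * X = X) :
    X.inv.carrier ⊆ Y.carrier := by
  intro A hA
  have hA' : A.inv ∈ (X * Y * X).carrier := by
    rw [h]
    exact hA
  obtain ⟨D, ⟨A₁, hA₁, B, hB, h1⟩, A₂, hA₂, h2⟩ := hA'
  have e1 : A.inv = A₁ := X.isPartialBisection.2 _ hA _ hA₁ (by
    rw [ran_eq_of_prod h2, ran_eq_of_prod h1])
  have e2 : A.inv = A₂ := X.isPartialBisection.1 _ hA _ hA₂ (by rw [dom_eq_of_prod h2])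
  have h3 := h2.inv_right
  rw [← e2, inv_invol] at h3
  have h4 := h1.inv_left
  rw [← e1, inv_invol] at h4
  have : B = A := ProperFilter.ext (by
    rw [h4.2, h3.2]
    change upMul A.carrier A.dom = _
    rw [mul_dom])
  rwa [← this]

instance : IsInverseSemigroup (Booleanization S) where
  existsUnique_inv X := by
    refine ⟨X.inv, ⟨X.mul_inv_mul, ?_⟩, ?_⟩
    · simpa only [inv_inv_eq] using X.inv.mul_inv_mul
    · rintro Y ⟨h1, h2⟩
      apply Booleanization.ext
      apply Set.Subset.antisymm
      · intro A hA
        have := carrier_inv_subset h2 (a := A.inv) (by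
          change A.inv.inv ∈ Y.carrier
          rwa [inv_invol])
        exact this
      · exact carrier_inv_subset h1

theorem sinv_eq (X : Booleanization S) : sinv X = X.inv :=
  (eq_sinv X.mul_inv_mul (by simpa only [inv_inv_eq] using X.inv.mul_inv_mul)).symm

/-- The canonical map `β : S → B(S)`, `a ↦ U_a`. -/
def β : S →ₙ* Booleanization S where
  toFun a := ⟨basicSet a ∅, isPartialBisection_basicSet a ∅,
    isFiniteUnion_basicSet Set.finite_empty (by simp)⟩
  map_mul' a b := Booleanization.ext (by
    rw [carrier_mul, prodSet_basicSet]
    simp)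

theorem isIdentity_of_idem {X : Booleanization S} (h : X * X = X) :
    ∀ A ∈ X.carrier, A.IsIdentity := by
  intro A hA
  have hA' : A ∈ (X * X).carrier := by rwa [h]
  obtain ⟨B, hB, C, hC, h'⟩ := hA'
  have e1 : A = B := X.isPartialBisection.2 _ hA _ hB (ran_eq_of_prod h')
  have e2 : A = C := X.isPartialBisection.1 _ hA _ hC (dom_eq_of_prod h')
  rw [← e1, ← e2] at h'
  exact A.isIdentity_iff.2 h'.inv_left.2

theorem ran_of_isIdentity {A : ProperFilter S} (h : A.IsIdentity) : A.ran = A.carrier := by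
  have h1 := A.isIdentity_iff.1 h
  have h2 : invSet A.carrier = A.carrier := by
    conv_lhs => rw [h1]
    rw [dom, invSet_upMul, invSet_invSet]
    exact h1.symm
  have h3 := A.mul_dom
  rw [← h1] at h3
  rw [ran, h2, h3]

theorem eq_of_prod_identity {A B C : ProperFilter S} (hB : B.IsIdentity) (h : IsProd A B C) :
    C = A := by
  apply ProperFilter.ext
  rw [h.2, ← ran_of_isIdentity hB, ← h.1, mul_dom]

theorem idem_of_isIdentity {X : Booleanization S} (h : ∀ A ∈ X.carrier, A.IsIdentity) :
    X * X = X := by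
  apply Booleanization.ext
  ext C
  constructor
  · rintro ⟨A, hA, B, hB, h'⟩
    rwa [eq_of_prod_identity (h B hB) h']
  · intro hC
    have h1 := C.isIdentity_iff.1 (h C hC)
    have h2 := C.mul_dom
    rw [← h1] at h2
    exact ⟨C, hC, C, hC, by rw [ran_of_isIdentity (h C hC), ← h1], h2.symm⟩

theorem natLE_iff {X Y : Booleanization S} : X ≼ Y ↔ X.carrier ⊆ Y.carrier := by
  constructor
  · rintro ⟨E, hE, rfl⟩ C ⟨A, hA, B, hB, h⟩
    rwa [eq_of_prod_identity (isIdentity_of_idem hE B hB) h]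
  · intro h
    refine ⟨sinv X * X, d_idem X, ?_⟩
    rw [sinv_eq]
    apply Booleanization.ext
    ext C
    constructor
    · intro hC
      obtain ⟨D, hD⟩ := exists_prod (A := C.inv) (B := C) (by rw [inv_dom])
      refine ⟨C, h hC, D, ⟨C.inv, by rwa [inv, Set.mem_preimage, inv_invol], C, hC, hD⟩, ?_⟩
      simpa only [inv_invol] using hD.inv_left
    · rintro ⟨A, hA, D, ⟨B, hB, B', hB', h1⟩, h2⟩
      have e1 : B.inv = B' := X.isPartialBisection.2 _ hB _ hB' (by rw [inv_ran, h1.1])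
      have e2 : A = B' := Y.isPartialBisection.1 _ hA _ (h hB') (by
        rw [h2.1, ran_eq_of_prod h1, ← e1, inv_dom])
      have h3 := h1
      rw [← e1] at h3
      have hD : D.carrier = A.dom := by
        rw [h1.2, e2, ← e1]
        simp only [dom, ProperFilter.inv, invSet_invSet]
      have : C = A := ProperFilter.ext (by rw [h2.2, hD, mul_dom])
      rw [this, e2]
      exact hB'

theorem isJoin_of_union {X Y Z : Booleanization S} (h : Z.carrier = X.carrier ∪ Y.carrier) :
    IsJoin X Y Z := by
  simp only [IsJoin, natLE_iff, h]
  exact ⟨Set.subset_union_left, Set.subset_union_right, fun W h1 h2 => Set.union_subset h1 h2⟩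

theorem exists_union {X Y : Booleanization S} (h : Compatible X Y) :
    ∃ Z : Booleanization S, Z.carrier = X.carrier ∪ Y.carrier := by
  obtain ⟨h1, h2⟩ := h
  rw [sinv_eq] at h1 h2
  have hr : ∀ A ∈ X.carrier, ∀ B ∈ Y.carrier, A.ran = B.ran → A = B := by
    intro A hA B hB h
    obtain ⟨D, hD⟩ := exists_prod (A := A.inv) (B := B) (by rw [inv_dom, h])
    have hi := isIdentity_of_idem h1 D
      ⟨A.inv, by rwa [inv, Set.mem_preimage, inv_invol], B, hB, hD⟩
    have h3 := hD.inv_left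
    rw [inv_invol] at h3
    exact (eq_of_prod_identity hi h3).symm
  have hd : ∀ A ∈ X.carrier, ∀ B ∈ Y.carrier, A.dom = B.dom → A = B := by
    intro A hA B hB h
    obtain ⟨D, hD⟩ := exists_prod (A := A) (B := B.inv) (by rw [inv_ran, h])
    have hi := isIdentity_of_idem h2 D
      ⟨A, hA, B.inv, by rwa [inv, Set.mem_preimage, inv_invol], hD⟩
    have h3 := eq_of_prod_identity hi hD.inv_left
    rw [← inv_invol B, h3, inv_invol]
  refine ⟨⟨_, ⟨?_, ?_⟩, X.isFiniteUnion.union Y.isFiniteUnion⟩, rfl⟩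
  · rintro A (hA | hA) B (hB | hB) h
    · exact X.isPartialBisection.1 _ hA _ hB h
    · exact hd _ hA _ hB h
    · exact (hd _ hB _ hA h.symm).symm
    · exact Y.isPartialBisection.1 _ hA _ hB h
  · rintro A (hA | hA) B (hB | hB) h
    · exact X.isPartialBisection.2 _ hA _ hB h
    · exact hr _ hA _ hB h
    · exact (hr _ hB _ hA h.symm).symm
    · exact Y.isPartialBisection.2 _ hA _ hB h

theorem carrier_of_isJoin {X Y Z : Booleanization S} (hc : Compatible X Y) (h : IsJoin X Y Z) :
    Z.carrier = X.carrier ∪ Y.carrier := by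
  obtain ⟨W, hW⟩ := exists_union hc
  have h' := isJoin_of_union hW
  rw [NatLE.antisymm (h.2.2 _ h'.1 h'.2.1) (h'.2.2 _ h.1 h.2.1), hW]

theorem idem_or_empty {a : S} {T : Set S} (hT : ∀ t ∈ T, t ≼ a)
    (h : ∀ A ∈ basicSet a T, A.IsIdentity) : a * a = a ∨ basicSet a T = ∅ := by
  by_cases ha : a = 0
  · left
    rw [ha, zero_mul]
  by_cases haT : a ∈ T
  · right
    ext A
    simp only [Set.mem_empty_iff_false, iff_false]
    exact fun hA => hA.2 a haT hA.1
  · left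
    obtain ⟨e, he, hee⟩ := h (principal a ha) ⟨natLE_refl a, fun t ht h' =>
      haT (by rwa [NatLE.antisymm h' (hT t ht)])⟩
    exact NatLE.idem he hee

theorem mul_mem_of_idem (A : ProperFilter S) {e f : S} (he : e * e = e) (hA : e ∈ A.carrier)
    (hf : f ∈ A.carrier) : e * f ∈ A.carrier := by
  obtain ⟨c, hc, h1, h2⟩ := A.directed hA hf
  have := h1.mul h2
  rw [h1.idem he] at this
  exact A.up hc this

theorem isFiniteUnion_diff_basicSet {e f : S} {T T' : Set S} (he : e * e = e) (hf : f * f = f)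
    (hT : T.Finite) (hT' : T'.Finite) (hTe : ∀ t ∈ T, t ≼ e) (hTf : ∀ t ∈ T', t ≼ f) :
    IsFiniteUnion (basicSet e T \ basicSet f T') := by
  have hTi : ∀ t ∈ T, t * t = t := fun t ht => (hTe t ht).idem he
  have hTi' : ∀ t ∈ T', t * t = t := fun t ht => (hTf t ht).idem hf
  have h1 : IsFiniteUnion (basicSet e (insert (e * f) T)) := by
    apply isFiniteUnion_basicSet (hT.insert _)
    rintro t (rfl | ht)
    · exact mul_idem_le hf e
    · exact hTe t ht
  have h2 : IsFiniteUnion (⋃₀ ((fun t => basicSet (e * t) ((fun x => x * (e * t)) '' T)) '' T')) := by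
    apply isFiniteUnion_sUnion (hT'.image _)
    rintro _ ⟨t, ht, rfl⟩
    apply isFiniteUnion_basicSet (hT.image _)
    rintro _ ⟨x, hx, rfl⟩
    exact idem_mul_le (hTi x hx) _
  convert h1.union h2 using 1
  ext A
  constructor
  · rintro ⟨⟨h3, h4⟩, h5⟩
    by_cases hfA : f ∈ A.carrier
    · right
      have : ∃ t ∈ T', t ∈ A.carrier := by
        by_contra! hne
        exact h5 ⟨hfA, hne⟩
      obtain ⟨t, ht, htA⟩ := this
      refine ⟨_, ⟨t, ht, rfl⟩, mul_mem_of_idem A he h3 htA, ?_⟩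
      rintro _ ⟨x, hx, rfl⟩ hxA
      exact h4 x hx (A.up hxA (mul_idem_le (idem_mul_idem he (hTi' t ht)) x))
    · left
      refine ⟨h3, ?_⟩
      rintro t (rfl | ht) htA
      · exact hfA (A.up htA (idem_mul_le he f))
      · exact h4 t ht htA
  · rintro (⟨h3, h4⟩ | ⟨_, ⟨t, ht, rfl⟩, h3, h4⟩)
    · exact ⟨⟨h3, fun t ht => h4 t (Or.inr ht)⟩, fun h5 =>
        h4 _ (Or.inl rfl) (mul_mem_of_idem A he h3 h5.1)⟩
    · refine ⟨⟨A.up h3 (mul_idem_le (hTi' t ht) e), fun x hx hxA => ?_⟩, fun h5 => ?_⟩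
      · exact h4 _ ⟨x, hx, rfl⟩ (mul_mem_of_idem A (hTi x hx) hxA h3)
      · exact h5.2 t ht (A.up h3 (idem_mul_le he t))

theorem isFiniteUnion_diff {X Y : Booleanization S} (hX : X * X = X) (hY : Y * Y = Y) :
    IsFiniteUnion (X.carrier \ Y.carrier) := by
  obtain ⟨G, hG, hGb, hGY⟩ := Y.isFiniteUnion
  have hGi : ∀ V ∈ G, ∀ A ∈ V, A.IsIdentity := fun V hV A hA =>
    isIdentity_of_idem hY A (by rw [hGY]; exact ⟨V, hV, hA⟩)
  rw [hGY]
  have main : ∀ H : Set (Set (ProperFilter S)), H.Finite → H ⊆ G →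
      IsFiniteUnion (X.carrier \ ⋃₀ H) := by
    intro H hH
    induction H, hH using Set.Finite.induction_on with
    | empty => intro _; simpa using X.isFiniteUnion
    | @insert V H _ _ ih =>
      intro hs
      obtain ⟨F, hF, hFb, hFX⟩ := ih ((Set.subset_insert _ _).trans hs)
      have e : X.carrier \ ⋃₀ (insert V H) = ⋃₀ ((fun U => U \ V) '' F) := by
        have : X.carrier \ ⋃₀ (insert V H) = (X.carrier \ ⋃₀ H) \ V := by
          ext A
          simp only [Set.sUnion_insert, Set.mem_sdiff, Set.mem_union]
          tauto
        rw [this, hFX]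
        ext A
        simp only [Set.mem_sdiff, Set.mem_sUnion, Set.exists_mem_image]
        constructor
        · rintro ⟨⟨U, hU, hA⟩, hV⟩
          exact ⟨U, hU, hA, hV⟩
        · rintro ⟨U, hU, hA, hV⟩
          exact ⟨⟨U, hU, hA⟩, hV⟩
      rw [e]
      apply isFiniteUnion_sUnion (hF.image _)
      rintro _ ⟨U, hU, rfl⟩
      have hVG : V ∈ G := hs (Set.mem_insert _ _)
      have hUi : ∀ A ∈ U, A.IsIdentity := fun A hA => isIdentity_of_idem hX A (by
        have : A ∈ ⋃₀ F := ⟨U, hU, hA⟩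
        rw [← hFX] at this
        exact this.1)
      have hVi := hGi V hVG
      obtain ⟨a, T, hT, hTa, rfl⟩ := hFb hU
      obtain ⟨b, T', hT', hTb, rfl⟩ := hGb hVG
      rcases idem_or_empty hTa hUi with ha | ha
      · rcases idem_or_empty hTb hVi with hb | hb
        · exact isFiniteUnion_diff_basicSet ha hb hT hT' hTa hTb
        · simpa only [hb, Set.sdiff_empty] using isFiniteUnion_basicSet hT hTa
      · simpa only [ha, Set.empty_sdiff] using isFiniteUnion_empty
  exact main G hG subset_rfl

instance : IsBooleanInverseSemigroup (Booleanization S) where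
  exists_join X Y h := by
    obtain ⟨Z, hZ⟩ := exists_union h
    exact ⟨Z, isJoin_of_union hZ⟩
  join_mul X Y Z W hc h := by
    have hZ := carrier_of_isJoin hc h
    apply isJoin_of_union
    ext C
    constructor
    · rintro ⟨A, hA, B, hB, h'⟩
      rw [hZ] at hA
      exact hA.imp (fun hA => ⟨A, hA, B, hB, h'⟩) (fun hA => ⟨A, hA, B, hB, h'⟩)
    · rintro (⟨A, hA, B, hB, h'⟩ | ⟨A, hA, B, hB, h'⟩)
      · exact ⟨A, by rw [hZ]; exact Or.inl hA, B, hB, h'⟩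
      · exact ⟨A, by rw [hZ]; exact Or.inr hA, B, hB, h'⟩
  mul_join X Y Z W hc h := by
    have hZ := carrier_of_isJoin hc h
    apply isJoin_of_union
    ext C
    constructor
    · rintro ⟨A, hA, B, hB, h'⟩
      rw [hZ] at hB
      exact hB.imp (fun hB => ⟨A, hA, B, hB, h'⟩) (fun hB => ⟨A, hA, B, hB, h'⟩)
    · rintro (⟨A, hA, B, hB, h'⟩ | ⟨A, hA, B, hB, h'⟩)
      · exact ⟨A, hA, B, by rw [hZ]; exact Or.inl hB, h'⟩
      · exact ⟨A, hA, B, by rw [hZ]; exact Or.inr hB, h'⟩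
  exists_compl E F hE hF hFE := by
    let G : Booleanization S := ⟨E.carrier \ F.carrier,
      E.isPartialBisection.subset Set.sdiff_subset, isFiniteUnion_diff hE hF⟩
    refine ⟨G, idem_of_isIdentity fun A hA => isIdentity_of_idem hE A hA.1, ?_, ?_⟩
    · apply Booleanization.ext
      ext C
      constructor
      · rintro ⟨A, hA, B, hB, h⟩
        have hA' := isIdentity_of_idem hE A hA.1
        have hB' := isIdentity_of_idem hF B hB
        have : A = B := ProperFilter.ext (by
          rw [A.isIdentity_iff.1 hA', h.1, ran_of_isIdentity hB'])
        exact (hA.2 (this ▸ hB)).elim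
      · intro h
        exact h.elim
    · exact isJoin_of_union (Set.sdiff_union_of_subset (natLE_iff.1 hFE)).symm

end WithZero

section Monoid

variable {S : Type*} [MonoidWithZero S] [IsInverseSemigroup S]

/-- If `S` is a monoid then so is `B(S)`, with identity `β 1`. -/
instance : MonoidWithZero (Booleanization S) where
  one := β 1
  one_mul X := Booleanization.ext (by
    obtain ⟨F, -, hF, hX⟩ := X.isFiniteUnion
    change prodSet (basicSet 1 ∅) X.carrier = X.carrier
    rw [hX]
    have h : ∀ U ∈ F, prodSet (basicSet 1 ∅) U = U := by
      intro U hU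
      obtain ⟨a, T, -, -, rfl⟩ := hF hU
      rw [prodSet_basicSet]
      simp
    ext C
    constructor
    · rintro ⟨A, hA, B, ⟨U, hU, hB⟩, h'⟩
      exact ⟨U, hU, by rw [← h U hU]; exact ⟨A, hA, B, hB, h'⟩⟩
    · rintro ⟨U, hU, hC⟩
      rw [← h U hU] at hC
      obtain ⟨A, hA, B, hB, h'⟩ := hC
      exact ⟨A, hA, B, ⟨U, hU, hB⟩, h'⟩)
  mul_one X := Booleanization.ext (by
    obtain ⟨F, -, hF, hX⟩ := X.isFiniteUnion
    change prodSet X.carrier (basicSet 1 ∅) = X.carrier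
    rw [hX]
    have h : ∀ U ∈ F, prodSet U (basicSet 1 ∅) = U := by
      intro U hU
      obtain ⟨a, T, -, -, rfl⟩ := hF hU
      rw [prodSet_basicSet]
      simp
    ext C
    constructor
    · rintro ⟨A, ⟨U, hU, hA⟩, B, hB, h'⟩
      exact ⟨U, hU, by rw [← h U hU]; exact ⟨A, hA, B, hB, h'⟩⟩
    · rintro ⟨U, hU, hC⟩
      rw [← h U hU] at hC
      obtain ⟨A, hA, B, hB, h'⟩ := hC
      exact ⟨A, ⟨U, hU, hA⟩, B, hB, h'⟩)
  zero_mul := zero_mul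
  mul_zero := mul_zero

end Monoid

end Booleanization

/-! ### Basic sets inside a partial bisection as a semiring of sets -/

namespace InvSemi

section Filters

variable {S : Type*} [SemigroupWithZero S] [IsInverseSemigroup S]

/-! Both parts reduce to one statement about the abelian group of integer-valued functions on the
set of proper filters: the indicator functions of the sets `U_a` with `a ≠ 0` are linearly
independent (`eq_zero_of_sum_indicator_eq_zero`). Indeed, if `b` is maximal in the support of a
combination, only the term of `b` survives at the principal filter of `b`. Since `U_0` is empty and
`θ 0 = 0`, there is an additive map `L` from the span of these indicators to the target with
`L(1_{U_a}) = θ a`. It is handled through its graph, `indicatorGraph`.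

The indicator of every `X` in `B(S)` lies in the span, so `X ↦ L(1_X)` is defined; this is `lift`.
It is additive because orthogonal joins are disjoint unions. It is multiplicative because, for a
fixed partial bisection, multiplication by it on either side is induced by an additive endomorphism
of the function group; both sides of the identity are then additive in each factor, and it suffices
to check it on `U_a U_b = U_{ab}`. Stars are treated likewise, with inversion of arrows.

Membership in the span and uniqueness both rest on `induction_on`: the image of `β` generates `B(S)`
under disjoint unions and relative complements. A set `U_{a; a₁, …, aₘ}` is a difference of two
basic sets with fewer exclusions, and each `X` is a finite disjoint union of basic sets because
those inside `X` form a semiring of sets (`IsPartialBisection.isSetSemiring`). -/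

theorem d_mul_idem (a : S) {e : S} (he : e * e = e) :
    sinv (a * e) * (a * e) = sinv a * a * e := by
  rw [sinv_mul, sinv_idem he]
  calc e * sinv a * (a * e) = e * (sinv a * a) * e := by simp only [mul_assoc]
    _ = sinv a * a * e := by rw [idem_comm he (d_idem a), mul_assoc, he]

theorem ProperFilter.d_mem_dom (A : ProperFilter S) {a : S} (ha : a ∈ A.carrier) :
    sinv a * a ∈ A.dom :=
  (A.mem_dom_iff _).2 ⟨a, ha, natLE_refl _⟩

/-- Together with `d_mem_dom` this shows that a filter containing `a` and `t` contains the
restriction `a t⁻¹ t`, which allows exclusions to be moved to smaller elements. -/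
theorem ProperFilter.mul_mem_of_mem_dom (A : ProperFilter S) {a x : S} (ha : a ∈ A.carrier)
    (hx : x ∈ A.dom) : a * x ∈ A.carrier := by
  rw [← A.mul_dom]
  exact ⟨a, ha, x, hx, natLE_refl _⟩

theorem ProperFilter.dom_principal (a : S) (ha : a ≠ 0) :
    (principal a ha).dom = {x | sinv a * a ≼ x} := by
  ext x
  rw [mem_dom_iff]
  exact ⟨fun ⟨c, hc, h⟩ => ((NatLE.sinv hc).mul hc).trans h, fun h => ⟨a, natLE_refl a, h⟩⟩

theorem mem_basicSets {a : S} {T : Set S} (hT : T.Finite) (hTa : ∀ t ∈ T, t ≼ a) :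
    basicSet a T ∈ basicSets S :=
  ⟨a, T, hT, hTa, rfl⟩

theorem empty_mem_basicSets : (∅ : Set (ProperFilter S)) ∈ basicSets S := by
  rw [← basicSet_zero (S := S) ∅]
  exact mem_basicSets Set.finite_empty (by simp)

/-- Below `t`, the exclusion of `x` amounts to that of the restriction of `x` to the domain
of `t`. -/
theorem basicSet_inter_basicSet_of_le {a t : S} (T T' : Set S) (h : t ≼ a) :
    basicSet a T ∩ basicSet t T' = basicSet t ((fun x => x * (sinv t * t)) '' T ∪ T') := by
  ext A
  constructor
  · rintro ⟨h1, h2⟩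
    refine ⟨h2.1, ?_⟩
    rintro _ (⟨x, hx, rfl⟩ | hx)
    · exact fun hA => h1.2 x hx (A.up hA (mul_idem_le (d_idem t) x))
    · exact h2.2 _ hx
  · rintro ⟨h1, h2⟩
    refine ⟨⟨A.up h1 h, fun x hx hA => ?_⟩, h1, fun x hx => h2 x (Or.inr hx)⟩
    exact h2 _ (Or.inl ⟨x, hx, rfl⟩) (A.mul_mem_of_mem_dom hA (A.d_mem_dom h1))

theorem mul_d_le_of_le {a t x : S} (h : t ≼ a) (hx : x ≼ a) : x * (sinv t * t) ≼ t := by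
  have := hx.mul (natLE_refl (sinv t * t))
  rwa [h.eq_mul_d] at this

theorem basicSet_inter_basicSet_mem {a t : S} {T T' : Set S} (hT : T.Finite) (hT' : T'.Finite)
    (hTa : ∀ x ∈ T, x ≼ a) (hTt : ∀ x ∈ T', x ≼ t) (h : t ≼ a) :
    basicSet a T ∩ basicSet t T' ∈ basicSets S := by
  rw [basicSet_inter_basicSet_of_le T T' h]
  refine mem_basicSets ((hT.image _).union hT') ?_
  rintro _ (⟨x, hx, rfl⟩ | hx)
  · exact mul_d_le_of_le h (hTa x hx)
  · exact hTt _ hx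

/-- Two basic sets inside a partial bisection have a basic set below the first one as their
intersection. -/
theorem IsPartialBisection.exists_basicSet_inter {X : Set (ProperFilter S)}
    (hX : IsPartialBisection X) {a b : S} {T T' : Set S} (hT' : T'.Finite)
    (ha : basicSet a T ⊆ X) (hb : basicSet b T' ⊆ X) (hTb : ∀ t ∈ T', t ≼ b) :
    ∃ (c : S) (T'' : Set S), T''.Finite ∧ c ≼ a ∧ (∀ t ∈ T'', t ≼ c) ∧
      basicSet a T ∩ basicSet b T' = basicSet a T ∩ basicSet c T'' := by
  -- The two elements are `a` and `b` restricted to their common domain. If they agree, the common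
  -- restriction is the required `c`; if not, the intersection turns out to be empty and `c = 0`
  -- serves.
  by_cases hc : a * (sinv b * b) = b * (sinv a * a)
  · refine ⟨a * (sinv b * b), (fun x => x * (sinv a * a)) '' T', hT'.image _,
      mul_idem_le (d_idem b) a, ?_, ?_⟩
    · rintro _ ⟨x, hx, rfl⟩
      rw [hc]
      exact (hTb x hx).mul (natLE_refl _)
    · ext A
      constructor
      · rintro ⟨h1, h2⟩
        refine ⟨h1, A.mul_mem_of_mem_dom h1.1 (A.d_mem_dom h2.1), ?_⟩
        rintro _ ⟨x, hx, rfl⟩ hA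
        exact h2.2 x hx (A.up hA (mul_idem_le (d_idem a) x))
      · rintro ⟨h1, h2⟩
        have h3 := h2.1
        rw [hc] at h3
        refine ⟨h1, A.up h3 (mul_idem_le (d_idem a) b), fun x hx hA => ?_⟩
        exact h2.2 _ ⟨x, hx, rfl⟩ (A.mul_mem_of_mem_dom hA (A.d_mem_dom h1.1))
  · refine ⟨0, ∅, Set.finite_empty, ⟨0, zero_mul 0, (mul_zero a).symm⟩, by simp, ?_⟩
    rw [basicSet_zero, Set.inter_empty]
    ext A
    simp only [Set.mem_empty_iff_false, iff_false]
    rintro ⟨h1, h2⟩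
    have h3 := A.mul_mem_of_mem_dom h1.1 (A.d_mem_dom h2.1)
    have h4 := A.mul_mem_of_mem_dom h2.1 (A.d_mem_dom h1.1)
    have h5 : a * (sinv b * b) ≠ 0 := fun h => A.zero_notMem (h ▸ h3)
    have h6 : b * (sinv a * a) ≠ 0 := fun h => A.zero_notMem (h ▸ h4)
    -- A filter in both basic sets makes both restrictions nonzero and keeps their principal filters
    -- clear of the exclusions. These principal filters then lie in `X` and have the same domain, so
    -- they coincide, and with them the restrictions.
    have h7 : principal _ h5 = principal _ h6 := by
      apply hX.1 _ (ha (show principal _ h5 ∈ basicSet a T from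
          ⟨mul_idem_le (d_idem b) a, fun t ht h =>
          h1.2 t ht (A.up h3 h)⟩)) _ (hb (show principal _ h6 ∈ basicSet b T' from
          ⟨mul_idem_le (d_idem a) b, fun t ht h => h2.2 t ht (A.up h4 h)⟩))
      rw [dom_principal, dom_principal, d_mul_idem a (d_idem b), d_mul_idem b (d_idem a),
        idem_comm (d_idem a) (d_idem b)]
    have h8 : ∀ x, a * (sinv b * b) ≼ x ↔ b * (sinv a * a) ≼ x :=
      fun x => Set.ext_iff.1 (congrArg ProperFilter.carrier h7) x
    exact hc (NatLE.antisymm ((h8 _).2 (natLE_refl _)) ((h8 _).1 (natLE_refl _)))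

/-- The difference of two basic sets is a finite disjoint union of basic sets. -/
theorem exists_finset_basicSet_diff {a c : S} {T T' : Set S} (hT : T.Finite) (hT' : T'.Finite)
    (hTa : ∀ t ∈ T, t ≼ a) (hca : c ≼ a) (hTc : ∀ t ∈ T', t ≼ c) :
    ∃ I : Finset (Set (ProperFilter S)), ↑I ⊆ basicSets S ∧
      (I : Set (Set (ProperFilter S))).PairwiseDisjoint id ∧
      basicSet a T \ basicSet c T' = ⋃₀ ↑I := by
  classical
  induction T', hT' using Set.Finite.induction_on with
  | empty =>
    -- Without exclusions at `c`, removing `U_c` just makes `c` a further exclusion.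
    refine ⟨{basicSet a (insert c T)}, ?_, by simp, ?_⟩
    · simp only [Finset.coe_singleton, Set.singleton_subset_iff]
      refine mem_basicSets (hT.insert c) ?_
      rintro t (rfl | ht)
      · exact hca
      · exact hTa t ht
    · ext A
      simp [basicSet]
      tauto
  | @insert t T' _ hT' ih =>
    have htc : t ≼ c := hTc t (Set.mem_insert _ _)
    have hTc' : ∀ x ∈ T', x ≼ c := fun x hx => hTc x (Set.mem_insert_of_mem _ hx)
    obtain ⟨I, hI, hd, he⟩ := ih hTc'
    -- A new exclusion `t` shrinks the set being removed by its part in `U_t`. The difference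
    -- therefore gains the basic set `U_{a;T} ∩ U_{c;T'} ∩ U_t`, which is disjoint from the old
    -- difference.
    have hJ : basicSet c T' ∩ basicSet t ∅ ∈ basicSets S :=
      basicSet_inter_basicSet_mem hT' Set.finite_empty hTc' (by simp) htc
    have hK : basicSet a T ∩ (basicSet c T' ∩ basicSet t ∅) ∈ basicSets S := by
      rw [basicSet_inter_basicSet_of_le T' ∅ htc]
      refine basicSet_inter_basicSet_mem hT ((hT'.image _).union Set.finite_empty) hTa ?_
        (htc.trans hca)
      rintro _ (⟨x, hx, rfl⟩ | hx)
      · exact mul_d_le_of_le htc (hTc' x hx)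
      · exact hx.elim
    refine ⟨insert (basicSet a T ∩ (basicSet c T' ∩ basicSet t ∅)) I, ?_, ?_, ?_⟩
    · rw [Finset.coe_insert]
      exact Set.insert_subset hK hI
    · rw [Finset.coe_insert]
      refine hd.insert fun V hV _ => ?_
      have hV' : V ⊆ basicSet a T \ basicSet c T' := by
        rw [he]
        exact Set.subset_sUnion_of_mem hV
      exact Set.disjoint_left.2 fun A hA hA' => (hV' hA').2 hA.2.1
    · rw [Finset.coe_insert, Set.sUnion_insert, ← he]
      ext A
      have := fun h => A.up (a := t) (b := c) h htc
      simp only [basicSet, Set.mem_sdiff, Set.mem_union, Set.mem_inter_iff, Set.mem_ofPred_eq,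
        Set.mem_insert_iff, forall_eq_or_imp, Set.mem_empty_iff_false, false_imp_iff,
        imp_true_iff, and_true]
      tauto

/-- The basic sets inside a partial bisection form a semiring of sets. -/
theorem IsPartialBisection.isSetSemiring {X : Set (ProperFilter S)} (hX : IsPartialBisection X) :
    MeasureTheory.IsSetSemiring {U | U ∈ basicSets S ∧ U ⊆ X} where
  empty_mem := ⟨empty_mem_basicSets, Set.empty_subset _⟩
  inter_mem := by
    rintro _ ⟨⟨a, T, hT, hTa, rfl⟩, ha⟩ _ ⟨⟨b, T', hT', hTb, rfl⟩, hb⟩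
    obtain ⟨c, T'', hT'', hca, hTc, h⟩ := hX.exists_basicSet_inter hT' ha hb hTb
    refine ⟨?_, Set.inter_subset_left.trans ha⟩
    rw [h]
    exact basicSet_inter_basicSet_mem hT hT'' hTa hTc hca
  sdiff_eq_sUnion' := by
    rintro _ ⟨⟨a, T, hT, hTa, rfl⟩, ha⟩ _ ⟨⟨b, T', hT', hTb, rfl⟩, hb⟩
    obtain ⟨c, T'', hT'', hca, hTc, h⟩ := hX.exists_basicSet_inter hT' ha hb hTb
    -- Only the part of the second set inside the first matters, so its top element may be replaced
    -- by some `c ≼ a`.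
    rw [← Set.sdiff_self_inter, h, Set.sdiff_self_inter]
    obtain ⟨I, hI, hd, he⟩ := exists_finset_basicSet_diff hT hT'' hTa hca hTc
    refine ⟨I, fun U hU => ⟨hI hU, ?_⟩, hd, he⟩
    have : U ⊆ ⋃₀ (I : Set (Set (ProperFilter S))) := Set.subset_sUnion_of_mem hU
    rw [← he] at this
    exact this.trans (Set.sdiff_subset.trans ha)

end Filters

end InvSemi

/-! ### Generation of `B(S)` by the image of `β`, and uniqueness of additive extensions -/

namespace Booleanization

section WithZero

variable {S : Type*} [SemigroupWithZero S] [IsInverseSemigroup S]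

/-- A property that holds on the image of `β` and is stable under disjoint joins and relative
complements holds on `B(S)`. -/
theorem induction_on {P : Booleanization S → Prop} (hβ : ∀ a, P (β a))
    (hunion : ∀ X Y Z : Booleanization S, Disjoint X.carrier Y.carrier →
      Z.carrier = X.carrier ∪ Y.carrier → P X → P Y → P Z)
    (hdiff : ∀ X Y Z : Booleanization S, Disjoint X.carrier Y.carrier →
      Z.carrier = X.carrier ∪ Y.carrier → P Z → P Y → P X) (X : Booleanization S) : P X := by
  classical
  -- For `t ∈ T`, the set `U_{a;T}` is `U_{a;T∖{t}}` minus `U_{t;T'}`, where `T'` consists of the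
  -- other exclusions restricted to the domain of `t`. Restriction may identify exclusions, so `T'`
  -- can have any smaller size and strong induction is needed.
  have hbasic : ∀ (n : ℕ) (T : Finset S) (a : S) (X : Booleanization S), T.card = n →
      (∀ t ∈ T, t ≼ a) → X.carrier = basicSet a T → P X := by
    intro n
    induction n using Nat.strong_induction_on with
    | _ n ih =>
      intro T a X hn hTa hX
      rcases T.eq_empty_or_nonempty with rfl | ⟨t, ht⟩
      · rw [show X = β a from Booleanization.ext (by rw [hX, Finset.coe_empty]; rfl)]
        exact hβ a
      · have hta := hTa t ht
        have hlt : (T.erase t).card < n := hn ▸ Finset.card_erase_lt_of_mem ht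
        have hTa' : ∀ x ∈ T.erase t, x ≼ a := fun x hx => hTa x (Finset.mem_of_mem_erase hx)
        set T' := (T.erase t).image (fun x => x * (sinv t * t)) with hT'
        have hTt : ∀ x ∈ T', x ≼ t := by
          intro x hx
          obtain ⟨y, hy, rfl⟩ := Finset.mem_image.1 hx
          exact mul_d_le_of_le hta (hTa' y hy)
        let Z : Booleanization S := ⟨basicSet a ↑(T.erase t), isPartialBisection_basicSet _ _,
          isFiniteUnion_basicSet (Finset.finite_toSet _) hTa'⟩
        let Y : Booleanization S := ⟨basicSet t ↑T', isPartialBisection_basicSet _ _,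
          isFiniteUnion_basicSet (Finset.finite_toSet _) hTt⟩
        have hY : Y.carrier = basicSet a ↑(T.erase t) ∩ basicSet t ∅ := by
          rw [basicSet_inter_basicSet_of_le _ _ hta, Set.union_empty, ← Finset.coe_image]
        refine hdiff X Y Z ?_ ?_ (ih _ hlt _ a Z rfl hTa' rfl)
          (ih _ (Finset.card_image_le.trans_lt hlt) T' t Y rfl hTt rfl)
        · rw [hX, hY]
          exact Set.disjoint_left.2 fun A hA hA' => hA.2 t ht hA'.2.1
        · rw [hX, hY]
          ext A
          have hta' := fun h => A.up (a := t) (b := a) h hta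
          change A ∈ basicSet a ↑(T.erase t) ↔ _
          rw [← Finset.insert_erase ht]
          simp only [basicSet, Finset.erase_insert (Finset.notMem_erase t T), Set.mem_union,
            Set.mem_inter_iff, Set.mem_ofPred_eq, Finset.coe_insert, Set.mem_insert_iff,
            forall_eq_or_imp, Set.mem_empty_iff_false, false_imp_iff, imp_true_iff, and_true]
          tauto
  -- Keeping the pieces inside `X` ensures that every partial union is again a partial bisection,
  -- hence an element of `B(S)`.
  have hsub : ∀ I : Finset (Set (ProperFilter S)),
      ↑I ⊆ {U | U ∈ basicSets S ∧ U ⊆ X.carrier} →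
      (I : Set (Set (ProperFilter S))).PairwiseDisjoint id →
      ∀ Y : Booleanization S, Y.carrier = ⋃₀ ↑I → P Y := by
    intro I
    induction I using Finset.induction_on with
    | empty =>
      intro _ _ Y hY
      exact hbasic 0 ∅ 0 Y rfl (by simp) (by rw [hY, basicSet_zero]; simp)
    | @insert U I hU ih =>
      intro hI hd Y hY
      rw [Finset.coe_insert] at hI hd hY
      rw [Set.sUnion_insert] at hY
      obtain ⟨⟨a, T, hT, hTa, rfl⟩, hUX⟩ := hI (Set.mem_insert _ _)
      have hI' := (Set.subset_insert _ _).trans hI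
      let V : Booleanization S := ⟨basicSet a T, isPartialBisection_basicSet _ _,
        isFiniteUnion_basicSet hT hTa⟩
      let W : Booleanization S := ⟨⋃₀ ↑I,
        X.isPartialBisection.subset (Set.sUnion_subset fun U hU => (hI' hU).2),
        ⟨↑I, I.finite_toSet, fun U hU => (hI' hU).1, rfl⟩⟩
      refine hunion V W Y ?_ hY ?_ (ih hI' (hd.subset (Set.subset_insert _ _)) W rfl)
      · refine Set.disjoint_sUnion_right.2 fun U' hU' => ?_
        exact hd (Set.mem_insert _ _) (Set.mem_insert_of_mem _ hU') (fun h => hU (h ▸ hU'))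
      · exact hbasic _ hT.toFinset a V rfl (by simpa using hTa) (by simp [V])
  obtain ⟨F, hF, hFb, hFX⟩ := X.isFiniteUnion
  -- The basic sets that make up `X` may overlap; the semiring property refines them to pairwise
  -- disjoint ones with the same union.
  have hC := X.isPartialBisection.isSetSemiring
  have hFC : ↑hF.toFinset ⊆ {U | U ∈ basicSets S ∧ U ⊆ X.carrier} := by
    intro U hU
    rw [Set.Finite.coe_toFinset] at hU
    exact ⟨hFb hU, by rw [hFX]; exact Set.subset_sUnion_of_mem hU⟩
  have hI : ((hF.toFinset.biUnion (hC.disjointOfUnion hFC) : Finset (Set (ProperFilter S))) :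
      Set (Set (ProperFilter S))) = ⋃ U ∈ hF.toFinset, ↑(hC.disjointOfUnion hFC U) := by
    rw [Finset.coe_biUnion]
    rfl
  refine hsub (hF.toFinset.biUnion (hC.disjointOfUnion hFC)) ?_ ?_ X ?_
  · rw [hI]
    exact Set.iUnion₂_subset fun U hU => hC.disjointOfUnion_subset hFC hU
  · rw [hI]
    exact hC.pairwiseDisjoint_biUnion_disjointOfUnion hFC
  · rw [hI, hC.sUnion_disjointOfUnion hFC, Set.Finite.coe_toFinset, hFX]

/-- An arrow of `X⁻¹ Y` comes from arrows of `X` and `Y` with equal range. Both lie in the partial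
bisection `Z`, so they are equal, against disjointness; for `X Y⁻¹` domains are used. -/
theorem orthogonal_of_disjoint {X Y Z : Booleanization S} (h : Disjoint X.carrier Y.carrier)
    (hZ : Z.carrier = X.carrier ∪ Y.carrier) : Orthogonal X Y := by
  have hXZ : X.carrier ⊆ Z.carrier := hZ ▸ Set.subset_union_left
  have hYZ : Y.carrier ⊆ Z.carrier := hZ ▸ Set.subset_union_right
  constructor
  · apply Booleanization.ext
    rw [sinv_eq]
    refine Set.eq_empty_of_forall_notMem ?_
    rintro C ⟨A, hA, B, hB, hC⟩
    have := Z.isPartialBisection.2 _ (hXZ hA) _ (hYZ hB) (by rw [inv_ran, hC.1])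
    exact Set.disjoint_left.1 h hA (this ▸ hB)
  · apply Booleanization.ext
    rw [sinv_eq]
    refine Set.eq_empty_of_forall_notMem ?_
    rintro C ⟨A, hA, B, hB, hC⟩
    have := Z.isPartialBisection.1 _ (hXZ hA) _ (hYZ hB) (by rw [inv_dom, hC.1])
    exact Set.disjoint_left.1 h hA (this ▸ hB)

/-- A common arrow `A` would put `A⁻¹ · A` into `X⁻¹ Y`, which is empty. -/
theorem disjoint_of_orthogonal {X Y : Booleanization S} (h : Orthogonal X Y) :
    Disjoint X.carrier Y.carrier := by
  refine Set.disjoint_left.2 fun A hA hA' => ?_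
  obtain ⟨D, hD⟩ := exists_prod (A := A.inv) (B := A) (by rw [inv_dom])
  have : D ∈ (sinv X * Y).carrier := by
    rw [sinv_eq]
    exact ⟨A.inv, by rwa [inv, Set.mem_preimage, inv_invol], A, hA', hD⟩
  rw [h.1] at this
  exact this

theorem carrier_of_isJoin_of_orthogonal {X Y Z : Booleanization S} (h : Orthogonal X Y)
    (hZ : IsJoin X Y Z) : Z.carrier = X.carrier ∪ Y.carrier :=
  carrier_of_isJoin ⟨by rw [h.1, zero_mul], by rw [h.2, zero_mul]⟩ hZ

/-- Additive maps on `B(S)` are determined by their values on the image of `β`. -/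
theorem eq_of_isAdditive {R : Type*} [AddCancelCommMonoid R] {φ ψ : Booleanization S → R}
    (hφ : IsAdditive φ) (hψ : IsAdditive ψ) (h : ∀ a, φ (β a) = ψ (β a)) (X : Booleanization S) :
    φ X = ψ X := by
  induction X using induction_on with
  | hβ a => exact h a
  | hunion X Y Z hd hZ hX hY =>
    have ho := orthogonal_of_disjoint hd hZ
    rw [hφ X Y Z ho (isJoin_of_union hZ), hψ X Y Z ho (isJoin_of_union hZ), hX, hY]
  | hdiff X Y Z hd hZ hPZ hY =>
    have ho := orthogonal_of_disjoint hd hZ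
    rw [hφ X Y Z ho (isJoin_of_union hZ), hψ X Y Z ho (isJoin_of_union hZ), hY] at hPZ
    exact add_right_cancel hPZ

end WithZero

end Booleanization

/-! ### Linear independence of indicators and additive maps given by graphs -/

namespace InvSemi

section Lift

variable {S : Type*} [SemigroupWithZero S] [IsInverseSemigroup S]

/-- The natural partial order as a `PartialOrder`. -/
abbrev natPartialOrder (S : Type*) [SemigroupWithZero S] [IsInverseSemigroup S] :
    PartialOrder S where
  le := NatLE
  le_refl := natLE_refl
  le_trans _ _ _ := NatLE.trans
  le_antisymm _ _ := NatLE.antisymm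

/-- The indicator functions of the sets `U_a`, `a ≠ 0`, are linearly independent over `ℤ`. -/
theorem eq_zero_of_sum_indicator_eq_zero {f : S →₀ ℤ}
    (h : f.sum (fun a n => n • (basicSet a ∅).indicator (1 : ProperFilter S → ℤ)) = 0) {a : S}
    (ha : a ≠ 0) : f a = 0 := by
  classical
  let := natPartialOrder S
  by_contra hfa
  -- The element 0 is left out because it generates no proper filter. At the principal filter of a
  -- maximal `b`, the indicator of `U_c` is nonzero only if `b ≼ c`, so only `c = b` contributes.
  have hs : (f.support.filter (· ≠ 0)).Nonempty := ⟨a, by simp [hfa, ha]⟩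
  obtain ⟨b, hb⟩ := Finset.exists_maximal hs
  obtain ⟨hb1, hb2⟩ := Finset.mem_filter.1 hb.prop
  have h1 := congrFun h (principal b hb2)
  rw [Finsupp.sum, Finset.sum_apply, Finset.sum_eq_single_of_mem b hb1] at h1
  · have h2 : principal b hb2 ∈ basicSet b ∅ := ⟨natLE_refl b, by simp⟩
    simp only [Pi.smul_apply, Set.indicator_of_mem h2, Pi.one_apply, Pi.zero_apply, smul_eq_mul,
      mul_one] at h1
    exact (Finsupp.mem_support_iff.1 hb1) h1
  · intro c hc hcb
    rw [Pi.smul_apply, Set.indicator_of_notMem, smul_zero]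
    rintro ⟨hbc : b ≼ c, -⟩
    have hc0 : c ≠ 0 := fun h0 => hb2 (eq_zero_of_le (h0 ▸ hbc))
    exact hcb (NatLE.antisymm (hb.2 (Finset.mem_filter.2 ⟨hc, hc0⟩) hbc) hbc)

/-- The graph of the additive map that sends the indicator function of `U_a` to `θ a`. -/
def indicatorGraph {R : Type*} [AddCommGroup R] (θ : S → R) :
    AddSubgroup ((ProperFilter S → ℤ) × R) :=
  AddSubgroup.closure (Set.range fun a => ((basicSet a ∅).indicator 1, θ a))

theorem mem_indicatorGraph {R : Type*} [AddCommGroup R] (θ : S → R) (a : S) :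
    ((basicSet a ∅).indicator 1, θ a) ∈ indicatorGraph θ :=
  AddSubgroup.subset_closure ⟨a, rfl⟩

/-- The graph is generated by the pairs of the `U_a`, so compatibility of two additive maps with the
graphs need only be checked there. Multiplicativity and preservation of stars are obtained in this
way. -/
theorem indicatorGraph_map {R R' : Type*} [AddCommGroup R] [AddCommGroup R'] {θ : S → R}
    {θ' : S → R'} (φ : (ProperFilter S → ℤ) →+ (ProperFilter S → ℤ)) (ψ : R →+ R')
    (h : ∀ a, (φ ((basicSet a ∅).indicator 1), ψ (θ a)) ∈ indicatorGraph θ')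
    {f : ProperFilter S → ℤ} {r : R} (hf : (f, r) ∈ indicatorGraph θ) :
    (φ f, ψ r) ∈ indicatorGraph θ' := by
  have : indicatorGraph θ ≤ (indicatorGraph θ').comap (φ.prodMap ψ) := by
    rw [indicatorGraph, AddSubgroup.closure_le]
    rintro _ ⟨a, rfl⟩
    exact h a
  exact this hf

/-- This is where linear independence enters: an integer combination of generators with first
coordinate 0 has zero coefficient at every `a ≠ 0`, and the term at `a = 0` vanishes because `θ 0 =
0`. -/
theorem eq_of_mem_indicatorGraph {R : Type*} [AddCommGroup R] {θ : S → R} (h0 : θ 0 = 0)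
    {f : ProperFilter S → ℤ} {r s : R} (hr : (f, r) ∈ indicatorGraph θ)
    (hs : (f, s) ∈ indicatorGraph θ) : r = s := by
  classical
  have key : ∀ p ∈ indicatorGraph θ, ∃ g : S →₀ ℤ,
      g.sum (fun a n => n • (basicSet a ∅).indicator (1 : ProperFilter S → ℤ)) = p.1 ∧
      g.sum (fun a n => n • θ a) = p.2 := by
    intro p hp
    induction hp using AddSubgroup.closure_induction with
    | mem x hx =>
      obtain ⟨a, rfl⟩ := hx
      exact ⟨Finsupp.single a 1, by simp, by simp⟩
    | zero => exact ⟨0, by simp, by simp⟩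
    | add x y _ _ hx hy =>
      obtain ⟨g, h1, h2⟩ := hx
      obtain ⟨g', h1', h2'⟩ := hy
      refine ⟨g + g', ?_, ?_⟩
      · rw [Finsupp.sum_add_index' (by simp) (by intros; rw [add_smul]), h1, h1', Prod.fst_add]
      · rw [Finsupp.sum_add_index' (by simp) (by intros; rw [add_smul]), h2, h2', Prod.snd_add]
    | neg x _ hx =>
      obtain ⟨g, h1, h2⟩ := hx
      refine ⟨-g, ?_, ?_⟩
      · rw [Finsupp.sum_neg_index (by simp), Prod.fst_neg, ← h1]
        simp [Finsupp.sum]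
      · rw [Finsupp.sum_neg_index (by simp), Prod.snd_neg, ← h2]
        simp [Finsupp.sum]
  obtain ⟨g, h1, h2⟩ := key _ (sub_mem hr hs)
  rw [Prod.fst_sub, sub_self] at h1
  rw [← sub_eq_zero]
  change _ = r - s at h2
  rw [← h2]
  refine Finset.sum_eq_zero fun a _ => ?_
  change g a • θ a = 0
  by_cases ha : a = 0
  · rw [ha, h0, smul_zero]
  · rw [eq_zero_of_sum_indicator_eq_zero h1 ha, zero_smul]

open Classical in
/-- The pullback of functions along a functional relation, extended by zero. -/
noncomputable def pullback {α : Type*} (ρ : α → α → Prop) : (α → ℤ) →+ (α → ℤ) where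
  toFun f x := if h : ∃ y, ρ x y then f h.choose else 0
  map_zero' := by ext x; simp
  map_add' f g := by
    ext x
    by_cases h : ∃ y, ρ x y <;> simp [h]

theorem pullback_indicator {α : Type*} {ρ : α → α → Prop}
    (hρ : ∀ x y z, ρ x y → ρ x z → y = z) (s : Set α) :
    pullback ρ (s.indicator 1) = {x | ∃ y ∈ s, ρ x y}.indicator 1 := by
  classical
  ext x
  change (if h : ∃ y, ρ x y then s.indicator (1 : α → ℤ) h.choose else 0) = _
  by_cases h : ∃ y, ρ x y
  · rw [dif_pos h]
    have : h.choose ∈ s ↔ x ∈ {x | ∃ y ∈ s, ρ x y} :=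
      ⟨fun hs => ⟨_, hs, h.choose_spec⟩, fun ⟨y, hy, hxy⟩ => by
        rwa [hρ x _ y h.choose_spec hxy]⟩
    simp only [Set.indicator_apply, this, Pi.one_apply]
  · rw [dif_neg h, Set.indicator_of_notMem]
    exact fun ⟨y, _, hxy⟩ => h ⟨y, hxy⟩

/-- If `C = A · B` with `A ∈ X`, the range of `C` determines `A`, and then `B = A⁻¹ · C`. Thus `C ↦
B` is a partial function, and pulling back along it gives an additive map defined on all functions.
-/
theorem IsPartialBisection.exists_map_prodSet_left {X : Set (ProperFilter S)}
    (hX : IsPartialBisection X) : ∃ φ : (ProperFilter S → ℤ) →+ (ProperFilter S → ℤ),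
      ∀ Y : Set (ProperFilter S), φ (Y.indicator 1) = (InvSemi.prodSet X Y).indicator 1 := by
  refine ⟨pullback fun C B => ∃ A ∈ X, IsProd A B C, fun Y => ?_⟩
  rw [pullback_indicator]
  · congr 1
    ext C
    exact ⟨fun ⟨B, hB, A, hA, h⟩ => ⟨A, hA, B, hB, h⟩, fun ⟨A, hA, B, hB, h⟩ => ⟨B, hB, A, hA, h⟩⟩
  · rintro C B B' ⟨A, hA, h⟩ ⟨A', hA', h'⟩
    obtain rfl := hX.2 _ hA _ hA' (by rw [← ran_eq_of_prod h, ← ran_eq_of_prod h'])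
    exact ProperFilter.ext (by rw [h.inv_left.2, h'.inv_left.2])

theorem IsPartialBisection.exists_map_prodSet_right {Y : Set (ProperFilter S)}
    (hY : IsPartialBisection Y) : ∃ φ : (ProperFilter S → ℤ) →+ (ProperFilter S → ℤ),
      ∀ X : Set (ProperFilter S), φ (X.indicator 1) = (InvSemi.prodSet X Y).indicator 1 := by
  refine ⟨pullback fun C A => ∃ B ∈ Y, IsProd A B C, fun X => ?_⟩
  rw [pullback_indicator]
  · rfl
  · rintro C A A' ⟨B, hB, h⟩ ⟨B', hB', h'⟩
    obtain rfl := hY.1 _ hB _ hB' (by rw [← dom_eq_of_prod h, ← dom_eq_of_prod h'])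
    exact ProperFilter.ext (by rw [h.inv_right.2, h'.inv_right.2])

end Lift

end InvSemi

/-! ### The additive extension and its compatibility with products and inverses -/

namespace Booleanization

section Lift

variable {S : Type*} [SemigroupWithZero S] [IsInverseSemigroup S]

theorem exists_mem_indicatorGraph {R : Type*} [AddCommGroup R] (θ : S → R)
    (X : Booleanization S) : ∃ r, (X.carrier.indicator 1, r) ∈ indicatorGraph θ := by
  induction X using induction_on with
  | hβ a => exact ⟨θ a, mem_indicatorGraph θ a⟩
  | hunion X Y Z hd hZ hX hY =>
    obtain ⟨r, hr⟩ := hX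
    obtain ⟨s, hs⟩ := hY
    refine ⟨r + s, ?_⟩
    rw [hZ, Set.indicator_union_of_disjoint hd]
    exact add_mem hr hs
  | hdiff X Y Z hd hZ hPZ hY =>
    obtain ⟨r, hr⟩ := hPZ
    obtain ⟨s, hs⟩ := hY
    refine ⟨r - s, ?_⟩
    rw [hZ, Set.indicator_union_of_disjoint hd] at hr
    have := sub_mem hr hs
    rwa [Prod.mk_sub_mk, show (fun A => X.carrier.indicator (1 : ProperFilter S → ℤ) A +
      Y.carrier.indicator 1 A) = X.carrier.indicator 1 + Y.carrier.indicator 1 from rfl,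
      add_sub_cancel_right] at this

/-- The additive extension of `θ` to `B(S)`. -/
noncomputable def lift {R : Type*} [AddCommGroup R] (θ : S → R) (X : Booleanization S) : R :=
  (exists_mem_indicatorGraph θ X).choose

theorem lift_mem {R : Type*} [AddCommGroup R] (θ : S → R) (X : Booleanization S) :
    (X.carrier.indicator 1, lift θ X) ∈ indicatorGraph θ :=
  (exists_mem_indicatorGraph θ X).choose_spec

/-- Since the graph is single-valued, the chosen value is independent of the choice, and each
identity for `lift` reduces to exhibiting a pair in the graph. -/
theorem lift_eq {R : Type*} [AddCommGroup R] {θ : S → R} (h0 : θ 0 = 0) {X : Booleanization S}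
    {r : R} (h : (X.carrier.indicator 1, r) ∈ indicatorGraph θ) : lift θ X = r :=
  eq_of_mem_indicatorGraph h0 (lift_mem θ X) h

theorem lift_β {R : Type*} [AddCommGroup R] {θ : S → R} (h0 : θ 0 = 0) (a : S) :
    lift θ (β a) = θ a :=
  lift_eq h0 (mem_indicatorGraph θ a)

theorem lift_zero {R : Type*} [AddCommGroup R] {θ : S → R} (h0 : θ 0 = 0) :
    lift θ 0 = 0 := by
  refine lift_eq h0 ?_
  rw [carrier_zero, Set.indicator_empty']
  exact zero_mem _

theorem isAdditive_lift {R : Type*} [AddCommGroup R] {θ : S → R} (h0 : θ 0 = 0) :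
    IsAdditive (lift θ) := by
  intro X Y Z ho hZ
  refine lift_eq h0 ?_
  rw [carrier_of_isJoin_of_orthogonal ho hZ,
    Set.indicator_union_of_disjoint (disjoint_of_orthogonal ho)]
  exact add_mem (lift_mem θ X) (lift_mem θ Y)

theorem lift_mul {R : Type*} [NonUnitalRing R] {θ : S → R} (h0 : θ 0 = 0)
    (hmul : ∀ a b, θ (a * b) = θ a * θ b) (X Y : Booleanization S) :
    lift θ (X * Y) = lift θ X * lift θ Y := by
  -- With `Y` fixed, right multiplication by `Y` and by `lift θ Y` are both additive, so `X` may be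
  -- replaced by `U_a`.
  obtain ⟨φ, hφ⟩ := Y.isPartialBisection.exists_map_prodSet_right
  refine lift_eq h0 ?_
  rw [carrier_mul, ← hφ]
  refine indicatorGraph_map φ (AddMonoidHom.mulRight (lift θ Y)) (fun a => ?_) (lift_mem θ X)
  -- With `a` fixed, the same argument on the left replaces `Y` by `U_b`, and `U_a U_b = U_{ab}`.
  obtain ⟨φ', hφ'⟩ := (isPartialBisection_basicSet a ∅).exists_map_prodSet_left
  rw [hφ, ← hφ']
  refine indicatorGraph_map φ' (AddMonoidHom.mulLeft (θ a)) (fun b => ?_) (lift_mem θ Y)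
  rw [hφ', prodSet_basicSet, Set.image_empty, Set.image_empty, Set.union_empty]
  change (_, θ a * θ b) ∈ _
  rw [← hmul]
  exact mem_indicatorGraph θ (a * b)

theorem lift_sinv {R : Type*} [AddCommGroup R] [StarAddMonoid R] {θ : S → R} (h0 : θ 0 = 0)
    (hstar : ∀ a, θ (sinv a) = star (θ a)) (X : Booleanization S) :
    lift θ (sinv X) = star (lift θ X) := by
  -- Composition with inversion of arrows sends the indicator of `X` to that of `X⁻¹`; it is matched
  -- with the additive map `star` on the target.
  let φ : (ProperFilter S → ℤ) →+ (ProperFilter S → ℤ) :=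
    { toFun := fun f A => f A.inv, map_zero' := rfl, map_add' := fun _ _ => rfl }
  have hφ : ∀ Y : Set (ProperFilter S),
      φ (Y.indicator 1) = (ProperFilter.inv ⁻¹' Y).indicator 1 := fun Y => rfl
  refine lift_eq h0 ?_
  rw [sinv_eq]
  change ((ProperFilter.inv ⁻¹' X.carrier).indicator 1, _) ∈ _
  rw [← hφ]
  refine indicatorGraph_map φ (starAddEquiv : R ≃+ R).toAddMonoidHom (fun a => ?_) (lift_mem θ X)
  rw [hφ, preimage_inv_basicSet, Set.image_empty]
  change (_, star (θ a)) ∈ _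
  rw [← hstar]
  exact mem_indicatorGraph θ (sinv a)

end Lift

end Booleanization

theorem mainTheorem10 :
    (∀ (S : Type*) [MonoidWithZero S] [IsInverseSemigroup S] (R : Type*) [Ring R] (θ : S →*₀ R),
      ∃! Θ : Booleanization S →*₀ R,
        IsAdditive Θ ∧ ∀ s : S, Θ (Booleanization.β s) = θ s) ∧
    (∀ (S : Type*) [SemigroupWithZero S] [IsInverseSemigroup S]
      (C : Type*) [NonUnitalCStarAlgebra C] (θ : S →ₙ* C), IsStarRep θ →
      ∃! Θ : Booleanization S →ₙ* C,
        IsStarRep Θ ∧ IsAdditive Θ ∧ ∀ s : S, Θ (Booleanization.β s) = θ s) := by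
  constructor
  · intro S _ _ R _ θ
    have h0 : θ 0 = 0 := map_zero θ
    refine ⟨{ toFun := Booleanization.lift θ
              map_zero' := Booleanization.lift_zero h0
              -- The identity of `B(S)` is `β 1` by definition.
              map_one' := (Booleanization.lift_β h0 1).trans (map_one θ)
              map_mul' := Booleanization.lift_mul h0 (map_mul θ) },
      ⟨Booleanization.isAdditive_lift h0, Booleanization.lift_β h0⟩, fun Φ hΦ => ?_⟩
    -- Additivity and the values on the image of `β` alone force uniqueness.
    refine MonoidWithZeroHom.ext (Booleanization.eq_of_isAdditive hΦ.1
      (Booleanization.isAdditive_lift h0) fun a => ?_)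
    exact (hΦ.2 a).trans (Booleanization.lift_β h0 a).symm
  · intro S _ _ C _ θ hθ
    have h0 : θ 0 = 0 := hθ.map_zero
    refine ⟨{ toFun := Booleanization.lift θ
              map_mul' := Booleanization.lift_mul h0 (map_mul θ) },
      ⟨⟨Booleanization.lift_zero h0, Booleanization.lift_sinv h0 hθ.map_inv⟩,
        Booleanization.isAdditive_lift h0, Booleanization.lift_β h0⟩, fun Φ hΦ => ?_⟩
    refine MulHom.ext (Booleanization.eq_of_isAdditive hΦ.2.1
      (Booleanization.isAdditive_lift h0) fun a => ?_)
    exact (hΦ.2.2 a).trans (Booleanization.lift_β h0 a).symm
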